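/- Let $(M,\langle\cdot,\cdot\rangle)$ be a complete, oriented smooth Riemannian surface without boundary, with Levi-Civita connection $\nabla$, and for $x\in M$ let $J^{90}_x\colon T_xM\to T_xM$ denote the rotation by the angle $\pi/2$ (in the positive sense). Let $\kappa\colon M\to\mathbb{R}$ be a smooth bounded function. Let $(a,b)\subseteq\mathbb{R}$ be a nonempty open interval, $-\infty\le a<b\le\infty$, and let $\gamma\colon(a,b)\to M$ be a $C^2$ curve satisfying \[ \nabla_{\gamma'}\gamma'=\kappa(\gamma)\,J^{90}_{\gamma}(\gamma')\qquad\text{on }(a,b). \] Then $\gamma$ extends to a solution on all of $\mathbb{R}$: there is a $C^2$ curve $\Gamma\colon\mathbb{R}\to M$ with $\Gamma|_{(a,b)}=\gamma$ and $\nabla_{\Gamma'}\Gamma'=\kappa(\Gamma)\,J^{90}_{\Gamma}(\Gamma')$ on $\mathbb{R}$. -/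

import Mathlib

open Bundle
open scoped Manifold ContDiff Bundle Topology

noncomputable section

namespace MagneticGeodesic

/-- The model plane `ℝ²`, with its Euclidean norm. -/
abbrev Plane : Type := EuclideanSpace ℝ (Fin 2)

section Orientation

/-- Tangent spaces of a surface are two-dimensional. -/
instance tangentSpace_finrank {M : Type*} [TopologicalSpace M] [ChartedSpace Plane M] (x : M) :
    Fact (Module.finrank ℝ (TangentSpace (𝓡 2) x) = 2) :=
  ⟨finrank_euclideanSpace_fin (𝕜 := ℝ) (n := 2)⟩

/-- An orientation of a surface `M`: a choice of an orientation of every tangent plane which is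
locally constant when the tangent planes near a point are identified with `ℝ²` by the
local trivialization of the tangent bundle given by the differential of a chart. -/
structure SurfaceOrientation (M : Type*) [TopologicalSpace M] [ChartedSpace Plane M]
    [IsManifold (𝓡 2) ∞ M] where
  /-- the orientation of the tangent plane at each point -/
  at_ : ∀ x : M, Orientation ℝ (TangentSpace (𝓡 2) x) (Fin 2)
  /-- continuity of the choice -/
  locally_constant : ∀ x₀ : M, ∃ o₀ : Orientation ℝ Plane (Fin 2), ∀ᶠ y in 𝓝 x₀,
    ∀ hy : y ∈ (trivializationAt Plane (TangentSpace (𝓡 2) : M → Type) x₀).baseSet,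
      Orientation.map (Fin 2)
        ((trivializationAt Plane (TangentSpace (𝓡 2) : M → Type) x₀).continuousLinearEquivAt
          ℝ y hy).toLinearEquiv (at_ y) = o₀

end Orientation

section Curves

variable {M : Type*} [TopologicalSpace M] [ChartedSpace Plane M]

/-- The velocity `γ'(t)`, a tangent vector at `γ t`. -/
def velocity (γ : ℝ → M) (t : ℝ) : TangentSpace (𝓡 2) (γ t) :=
  mfderiv 𝓘(ℝ, ℝ) (𝓡 2) γ t (1 : ℝ)

/-- The coordinate vector field `∂ᵢ` of the chart around `x₀`, at the point with coordinates
`u`. -/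
def coordVector (x₀ : M) (u : Plane) (i : Fin 2) :
    TangentSpace (𝓡 2) ((extChartAt (𝓡 2) x₀).symm u) :=
  mfderiv (𝓡 2) (𝓡 2) (extChartAt (𝓡 2) x₀).symm u (EuclideanSpace.single i (1 : ℝ) : Plane)

/-- The partial derivative `∂f/∂uⁱ` of a function on the plane. -/
def partialDeriv (i : Fin 2) (f : Plane → ℝ) (u : Plane) : ℝ :=
  fderiv ℝ f u (EuclideanSpace.single i (1 : ℝ))

variable [RiemannianBundle (fun x : M ↦ TangentSpace (𝓡 2) x)]

/-- The matrix `gᵢⱼ = ⟨∂ᵢ, ∂ⱼ⟩` of the Riemannian metric in the chart around `x₀`, as a function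
of the coordinates `u`. -/
def metricMatrix (x₀ : M) (u : Plane) : Matrix (Fin 2) (Fin 2) ℝ :=
  Matrix.of fun i j ↦ inner ℝ (coordVector x₀ u i) (coordVector x₀ u j)

/-- The Christoffel symbols of the Levi-Civita connection in the chart around `x₀`:
`Γᵏᵢⱼ = ½ ∑ₗ gᵏˡ (∂ᵢ gⱼₗ + ∂ⱼ gᵢₗ - ∂ₗ gᵢⱼ)`. -/
def christoffel (x₀ : M) (k i j : Fin 2) (u : Plane) : ℝ :=
  1 / 2 * ∑ l : Fin 2, (metricMatrix x₀ u)⁻¹ k l *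
    (partialDeriv i (fun v ↦ metricMatrix x₀ v j l) u
      + partialDeriv j (fun v ↦ metricMatrix x₀ v i l) u
      - partialDeriv l (fun v ↦ metricMatrix x₀ v i j) u)

/-- The components of `∇_{γ'} γ'` at time `t` in the chart `φ` around `x₀`: with `c = φ ∘ γ`,
the `k`-th component is `(cᵏ)'' + ∑ᵢⱼ Γᵏᵢⱼ(c) (cⁱ)' (cʲ)'`. -/
def accelerationCoord (x₀ : M) (γ : ℝ → M) (t : ℝ) : Plane :=
  let c : ℝ → Plane := fun s ↦ extChartAt (𝓡 2) x₀ (γ s)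
  WithLp.toLp 2 fun k ↦ deriv (deriv c) t k +
    ∑ i : Fin 2, ∑ j : Fin 2, christoffel x₀ k i j (c t) * deriv c t i * deriv c t j

/-- The covariant acceleration `∇_{γ'} γ'` at time `t` for the Levi-Civita connection: the tangent
vector at `γ t` whose components in the chart around `γ t` are given by the usual formula.
(The differential of a chart at a point of its domain is invertible.) -/
def covariantAcceleration (γ : ℝ → M) (t : ℝ) : TangentSpace (𝓡 2) (γ t) :=
  (mfderiv (𝓡 2) (𝓡 2) (extChartAt (𝓡 2) (γ t)) (γ t)).inverse
    (accelerationCoord (γ t) γ t)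

/-- The rotation `J⁹⁰` of the tangent plane at `x` by the angle `π / 2`, in the positive sense for
the given orientation. -/
def rotation90 [IsManifold (𝓡 2) ∞ M] (o : SurfaceOrientation M) (x : M) :
    TangentSpace (𝓡 2) x ≃ₗᵢ[ℝ] TangentSpace (𝓡 2) x :=
  (o.at_ x).rightAngleRotation

/-- `γ` is, on the open set `s` of times, a (classical) solution of the prescribed geodesic
curvature equation `∇_{γ'} γ' = κ J⁹⁰(γ')`. -/
structure IsMagneticGeodesicOn [IsManifold (𝓡 2) ∞ M] (o : SurfaceOrientation M) (κ : M → ℝ)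
    (γ : ℝ → M) (s : Set ℝ) : Prop where
  contMDiffOn : ContMDiffOn 𝓘(ℝ, ℝ) (𝓡 2) 2 γ s
  equation : ∀ t ∈ s,
    covariantAcceleration γ t = κ (γ t) • rotation90 o (γ t) (velocity γ t)

end Curves

end MagneticGeodesic

end

/-! The rotation by a right angle sends each vector to an orthogonal one, so the force `κ J⁹⁰(γ')`
does no work and a solution has constant speed. It is therefore Lipschitz for the Riemannian
distance, and completeness of the surface gives a limit point `p` of `γ` at every finite boundary
time. In the chart around `p` the equation is a first-order autonomous system with smooth right-hand
side on positions and velocities. Bounded speed gives bounded coordinate velocities near `p`, hence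
a cluster point of the phase curve. Solutions starting near that cluster point live for a uniform
time, so one started on `γ` close enough to the boundary time passes it; uniqueness glues it to `γ`
(`IsMagneticGeodesicOn.exists_extension_past`). Zorn's lemma then yields a maximal solution, whose
interval must be closed as well as open (`exists_global_of_exists_extension`).

The covariant acceleration is defined at each time in the chart centred at the current point,
whereas the ODE needs one fixed chart. The bridge is the acceleration with lowered index, the
Euler-Lagrange expression of the energy `½ G(c', c')`. It contains no inverse metric, and its
invariance under coordinate changes (`loweredAcceleration_comp`) transports the equation between
charts (`EquationInChart.change`). -/

open Set Filter

namespace MagneticGeodesic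

/-! ### Acceleration with lowered index in a vector space with variable metric -/

section LoweredAcceleration

variable {E E' : Type*} [NormedAddCommGroup E] [NormedSpace ℝ E]
  [NormedAddCommGroup E'] [NormedSpace ℝ E']

/-- The covariant acceleration of the curve `c`, with its index lowered by the metric `G`. -/
noncomputable def loweredAcceleration (G : E → E →L[ℝ] E →L[ℝ] ℝ) (c : ℝ → E) (t : ℝ) (w : E) : ℝ :=
  fderiv ℝ G (c t) (deriv c t) (deriv c t) w + G (c t) (deriv (deriv c) t) w
    - 1 / 2 * fderiv ℝ G (c t) w (deriv c t) (deriv c t)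

theorem differentiableAt_deriv_of_contDiffAt_two {c : ℝ → E} {t : ℝ} (hc : ContDiffAt ℝ 2 c t) :
    DifferentiableAt ℝ (deriv c) t := by
  have h : ContDiffAt ℝ 1 (fderiv ℝ c) t := hc.fderiv_right (m := 1) (by norm_num)
  have h2 := (h.differentiableAt one_ne_zero).clm_apply (differentiableAt_const (1 : ℝ))
  exact h2

theorem hasDerivAt_comp_of_differentiableAt {F : Type*} [NormedAddCommGroup F] [NormedSpace ℝ F]
    {G : E → F} {c : ℝ → E} {c' : E} {t : ℝ} (hG : DifferentiableAt ℝ G (c t))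
    (hc : HasDerivAt c c' t) : HasDerivAt (fun s ↦ G (c s)) (fderiv ℝ G (c t) c') t :=
  hG.hasFDerivAt.comp_hasDerivAt t hc

theorem hasFDerivAt_comp_of_differentiableAt {F : Type*} [NormedAddCommGroup F] [NormedSpace ℝ F]
    {G : E' → F} {τ : E → E'} {τ' : E →L[ℝ] E'} {x : E} (hG : DifferentiableAt ℝ G (τ x))
    (hτ : HasFDerivAt τ τ' x) :
    HasFDerivAt (fun z ↦ G (τ z)) ((fderiv ℝ G (τ x)).comp τ') x :=
  hG.hasFDerivAt.comp x hτ

/-- For `w = c'` the two derivative terms of the metric combine to one half of `DG(c')(c', c')`, and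
symmetry of `G` merges the two terms with `c''`. This reduces conservation of speed to the vanishing
of the acceleration against the velocity. -/
theorem hasDerivAt_metric_deriv_deriv {G : E → E →L[ℝ] E →L[ℝ] ℝ} {c : ℝ → E} {t : ℝ}
    (hG : DifferentiableAt ℝ G (c t)) (hsymm : ∀ v w, G (c t) v w = G (c t) w v)
    (hc : ContDiffAt ℝ 2 c t) :
    HasDerivAt (fun s ↦ G (c s) (deriv c s) (deriv c s))
      (2 * loweredAcceleration G c t (deriv c t)) t := by
  have h1 : HasDerivAt c (deriv c t) t := (hc.differentiableAt two_ne_zero).hasDerivAt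
  have h2 : HasDerivAt (deriv c) (deriv (deriv c) t) t :=
    (differentiableAt_deriv_of_contDiffAt_two hc).hasDerivAt
  have hGc : HasDerivAt (fun s ↦ G (c s)) (fderiv ℝ G (c t) (deriv c t)) t :=
    hasDerivAt_comp_of_differentiableAt (F := E →L[ℝ] E →L[ℝ] ℝ) (G := G) hG h1
  have hGc1 := hGc.clm_apply h2
  have h3 := hGc1.clm_apply h2
  refine h3.congr_deriv ?_
  simp only [loweredAcceleration, add_apply]
  rw [hsymm (deriv c t) (deriv (deriv c) t)]
  ring

/-- Naturality of the lowered acceleration under changes of coordinates. -/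
theorem loweredAcceleration_comp {G : E → E →L[ℝ] E →L[ℝ] ℝ} {G' : E' → E' →L[ℝ] E' →L[ℝ] ℝ}
    {τ : E → E'} {c : ℝ → E} {t : ℝ} (hτ : ContDiffAt ℝ 2 τ (c t)) (hc : ContDiffAt ℝ 2 c t)
    (hG : DifferentiableAt ℝ G (c t)) (hG' : DifferentiableAt ℝ G' (τ (c t)))
    (hpull : ∀ᶠ z in 𝓝 (c t), ∀ v w, G z v w = G' (τ z) (fderiv ℝ τ z v) (fderiv ℝ τ z w))
    (hsymm : ∀ v w, G' (τ (c t)) v w = G' (τ (c t)) w v) (w : E) :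
    loweredAcceleration G c t w = loweredAcceleration G' (τ ∘ c) t (fderiv ℝ τ (c t) w) := by
  have h1 : HasDerivAt c (deriv c t) t := (hc.differentiableAt two_ne_zero).hasDerivAt
  have h2 : HasDerivAt (deriv c) (deriv (deriv c) t) t :=
    (differentiableAt_deriv_of_contDiffAt_two hc).hasDerivAt
  have hτ1 : HasFDerivAt τ (fderiv ℝ τ (c t)) (c t) :=
    (hτ.differentiableAt two_ne_zero).hasFDerivAt
  have hτ2 : HasFDerivAt (fderiv ℝ τ) (fderiv ℝ (fderiv ℝ τ) (c t)) (c t) :=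
    ((hτ.fderiv_right (m := 1) (by norm_num)).differentiableAt one_ne_zero).hasFDerivAt
  have hd : ∀ᶠ s in 𝓝 t, deriv (τ ∘ c) s = fderiv ℝ τ (c s) (deriv c s) := by
    have e1 := hc.eventually (by simp)
    have e2 := h1.continuousAt.eventually (hτ.eventually (by simp))
    filter_upwards [e1, e2] with s hs1 hs2
    exact ((hs2.differentiableAt two_ne_zero).hasFDerivAt.comp_hasDerivAt s
      (hs1.differentiableAt two_ne_zero).hasDerivAt).deriv
  have hdd : deriv (deriv (τ ∘ c)) t = fderiv ℝ (fderiv ℝ τ) (c t) (deriv c t) (deriv c t)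
      + fderiv ℝ τ (c t) (deriv (deriv c) t) := by
    rw [EventuallyEq.deriv_eq hd]
    exact ((hτ2.comp_hasDerivAt t h1).clm_apply h2).deriv
  -- Differentiating the pullback identity produces second derivatives of `τ`. One of them is
  -- absorbed by `(τ ∘ c)''`; the others cancel because the second derivative of `τ` and the metric
  -- `G'` are symmetric.
  have hDG : ∀ h v u, fderiv ℝ G (c t) h v u =
      fderiv ℝ G' (τ (c t)) (fderiv ℝ τ (c t) h) (fderiv ℝ τ (c t) v) (fderiv ℝ τ (c t) u)
      + G' (τ (c t)) (fderiv ℝ (fderiv ℝ τ) (c t) h v) (fderiv ℝ τ (c t) u)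
      + G' (τ (c t)) (fderiv ℝ τ (c t) v) (fderiv ℝ (fderiv ℝ τ) (c t) h u) := by
    intro h v u
    have b1 := hG.hasFDerivAt.clm_apply (hasFDerivAt_const v (c t))
    have a1 := b1.clm_apply (hasFDerivAt_const u (c t))
    have hGτ :=
      hasFDerivAt_comp_of_differentiableAt (F := E' →L[ℝ] E' →L[ℝ] ℝ) (G := G') hG' hτ1
    have hv := hτ2.clm_apply (hasFDerivAt_const v (c t))
    have hu := hτ2.clm_apply (hasFDerivAt_const u (c t))
    have hGv := hGτ.clm_apply hv
    have a2 := hGv.clm_apply hu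
    have heq : (fun z ↦ G z v u) =ᶠ[𝓝 (c t)]
        fun z ↦ G' (τ z) (fderiv ℝ τ z v) (fderiv ℝ τ z u) := by
      filter_upwards [hpull] with z hz using hz v u
    have a3 := a2.congr_of_eventuallyEq heq
    have := congrArg (fun L ↦ L h) (a1.unique a3)
    simp at this
    rw [this]
    ring
  have hsw : fderiv ℝ (fderiv ℝ τ) (c t) (deriv c t) w
      = fderiv ℝ (fderiv ℝ τ) (c t) w (deriv c t) :=
    (hτ.isSymmSndFDerivAt (by simp)).eq _ _
  have hpt := hpull.self_of_nhds
  simp only [loweredAcceleration, Function.comp_apply]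
  rw [hDG, hDG, hd.self_of_nhds, hdd, hpt, hsw]
  simp only [map_add, add_apply]
  rw [hsymm (fderiv ℝ (fderiv ℝ τ) (c t) w (deriv c t)) (fderiv ℝ τ (c t) (deriv c t))]
  ring

end LoweredAcceleration

/-! ### Local existence with uniform time, and uniqueness, for autonomous equations -/

section ODE

variable {E : Type*} [NormedAddCommGroup E] [NormedSpace ℝ E]

/-- Solutions of an autonomous `C¹` equation with initial values near `z₀` exist for a uniform
time, during which they stay in a prescribed neighbourhood of `z₀`. -/
theorem exists_uniform_local_solution [CompleteSpace E] {F : E → E} {z₀ : E}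
    (hF : ContDiffAt ℝ 1 F z₀) {U : Set E} (hU : U ∈ 𝓝 z₀) :
    ∃ ε > 0, ∃ V ∈ 𝓝 z₀, ∀ ε' > 0, ε' ≤ ε → ∀ t₀ : ℝ, ∀ z ∈ V, ∃ α : ℝ → E, α t₀ = z ∧
      ∀ t ∈ Ioo (t₀ - ε') (t₀ + ε'), HasDerivAt α (F (α t)) t ∧ α t ∈ U := by
  obtain ⟨ε, hε, a, r, L, K, hr, hpl⟩ := IsPicardLindelof.of_contDiffAt_one hF
  obtain ⟨δ, hδ, hδU⟩ := Metric.nhds_basis_closedBall.mem_iff.1 hU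
  -- The Picard-Lindelöf constraint bounds `L * ε` by `a - r`, and `r` is positive.
  have ha : 0 < a := by
    have h := (hpl 0).mul_max_le
    have h2 : (0 : ℝ) ≤ L * max (0 + ε - 0) (0 - (0 - ε)) := by simp; positivity
    have : (0 : ℝ) < r := hr
    have : (0 : ℝ) < a := by linarith [h, h2]
    exact this
  -- The outer radius is at most `δ`, which confines solutions to `U`; half of it is left as the
  -- radius of the ball of initial values that share the lifetime `ε'`.
  obtain ⟨ε', hε', hpl'⟩ := (hpl 0).exists_shrink_radius hε (a' := min a ⟨δ, hδ.le⟩)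
    (r' := min a ⟨δ, hδ.le⟩ / 2) (min_le_left _ _)
    (NNReal.half_lt_self (ne_of_gt (lt_min ha hδ)))
  have hsub : Metric.closedBall z₀ ((min a ⟨δ, hδ.le⟩ : NNReal) : ℝ) ⊆ U :=
    (Metric.closedBall_subset_closedBall (by
      exact (NNReal.coe_le_coe.2 (min_le_right a ⟨δ, hδ.le⟩)))).trans hδU
  refine ⟨ε', hε', Metric.closedBall z₀ ((min a ⟨δ, hδ.le⟩ / 2 : NNReal) : ℝ),
    Metric.closedBall_mem_nhds _ (by
      have : 0 < (min a ⟨δ, hδ.le⟩ / 2 : NNReal) := half_pos (lt_min ha hδ)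
      exact this), ?_⟩
  intro ε₁ hε₁ hle t₀ z hz
  obtain ⟨β, hβ⟩ := ODE.FunSpace.exists_isFixedPt_next hpl' hz
  have hβ0 : β.compProj 0 = z := by
    rw [ODE.FunSpace.compProj_of_mem (by constructor <;> linarith), ← hβ]
    exact ODE.FunSpace.next_apply₀ hpl' hz β
  have hβd : ∀ t ∈ Icc (0 - ε') (0 + ε'),
      HasDerivWithinAt β.compProj (F (β.compProj t)) (Icc (0 - ε') (0 + ε')) t := by
    intro t ht
    apply ODE.hasDerivWithinAt_picard_Icc (t₀ := 0) (by constructor <;> linarith)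
      hpl'.continuousOn_uncurry
      β.continuous_compProj.continuousOn (fun _ ht' ↦ β.compProj_mem_closedBall hpl'.mul_max_le)
      z ht |>.congr_of_mem _ ht
    intro t' ht'
    nth_rw 1 [← hβ]
    rw [ODE.FunSpace.compProj_of_mem ht', ODE.FunSpace.next_apply]
  -- The equation is autonomous, so the solution built at time `0` is translated to start at `t₀`.
  refine ⟨fun t ↦ β.compProj (t - t₀), by simpa only [sub_self] using hβ0, fun t ht ↦ ⟨?_, ?_⟩⟩
  · have hmem : t - t₀ ∈ Ioo (0 - ε') (0 + ε') := by
      constructor <;> linarith [ht.1, ht.2]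
    have := (hβd (t - t₀) (Ioo_subset_Icc_self hmem)).hasDerivAt (Icc_mem_nhds hmem.1 hmem.2)
    exact this.comp_sub_const t t₀
  · exact hsub (β.compProj_mem_closedBall hpl'.mul_max_le)

/-- Uniqueness for an autonomous equation whose right-hand side is `C¹` along the first
solution. -/
theorem eqOn_of_solutions {F : E → E} {I : Set ℝ} (hI : IsPreconnected I) (hIo : IsOpen I)
    {f g : ℝ → E} (hF : ∀ t ∈ I, ContDiffAt ℝ 1 F (f t))
    (hf : ∀ t ∈ I, HasDerivAt f (F (f t)) t) (hg : ∀ t ∈ I, HasDerivAt g (F (g t)) t)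
    {t₀ : ℝ} (ht₀ : t₀ ∈ I) (h : f t₀ = g t₀) : EqOn f g I := by
  -- The times at which the germs agree form an open set. It is relatively closed in `I`, since at a
  -- limit time the values agree by continuity and local uniqueness then gives equal germs.
  have hsub : I ⊆ {t | f =ᶠ[𝓝 t] g} := by
    have loc : ∀ t ∈ I, f t = g t → f =ᶠ[𝓝 t] g := by
      intro t ht hfg
      obtain ⟨K, s, hs, hl⟩ := (hF t ht).exists_lipschitzOnWith
      have hIt := hIo.mem_nhds ht
      refine ODE_solution_unique_of_eventually (v := fun _ ↦ F) (s := fun _ ↦ s) (K := K)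
        (Eventually.of_forall fun _ ↦ hl) ?_ ?_ hfg
      · filter_upwards [hIt, (hf t ht).continuousAt.preimage_mem_nhds hs] with x hx hxs
        exact ⟨hf x hx, hxs⟩
      · filter_upwards [hIt, (hg t ht).continuousAt.preimage_mem_nhds (hfg ▸ hs)] with x hx hxs
        exact ⟨hg x hx, hxs⟩
    refine hI.subset_of_closure_inter_subset isOpen_setOfPred_eventually_nhds
      ⟨t₀, ht₀, loc t₀ ht₀ h⟩ ?_
    rintro t ⟨htc, ht⟩
    refine loc t ht ?_
    by_contra hne
    have hopen : ∀ᶠ x in 𝓝 t, f x ≠ g x :=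
      ((hf t ht).continuousAt.ne_iff_eventually_ne (hg t ht).continuousAt).1 hne
    obtain ⟨x, hx1, hx2⟩ := mem_closure_iff_nhds.1 htc _ hopen
    exact hx1 hx2.self_of_nhds
  exact fun t ht ↦ (hsub ht).self_of_nhds

end ODE

/-! ### Coordinate frames and changes of chart -/

section ChartFrame

variable {M : Type*} [TopologicalSpace M] [ChartedSpace Plane M] [IsManifold (𝓡 2) ∞ M]

/-- The differential of the inverse of the chart around `x₀`, at the point `y` of the surface. -/
noncomputable def chartFrame (x₀ y : M) : Plane →L[ℝ] TangentSpace (𝓡 2) y :=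
  (trivializationAt Plane (TangentSpace (𝓡 2) : M → Type _) x₀).symmL ℝ y

theorem chartFrame_mfderiv {x₀ y : M} (hy : y ∈ (chartAt Plane x₀).source)
    (v : TangentSpace (𝓡 2) y) :
    chartFrame x₀ y (mfderiv (𝓡 2) (𝓡 2) (extChartAt (𝓡 2) x₀) y v) = v := by
  have h := TangentBundle.continuousLinearMapAt_trivializationAt (I := 𝓡 2) hy
  have h2 := (trivializationAt Plane (TangentSpace (𝓡 2) : M → Type _)
    x₀).symmL_continuousLinearMapAt (R := ℝ) (b := y) (by simpa using hy) v
  rw [h] at h2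
  exact h2

theorem mfderiv_chartFrame {x₀ y : M} (hy : y ∈ (chartAt Plane x₀).source) (v : Plane) :
    mfderiv (𝓡 2) (𝓡 2) (extChartAt (𝓡 2) x₀) y (chartFrame x₀ y v) = v := by
  have h := TangentBundle.continuousLinearMapAt_trivializationAt (I := 𝓡 2) hy
  have h2 := (trivializationAt Plane (TangentSpace (𝓡 2) : M → Type _)
    x₀).continuousLinearMapAt_symmL (R := ℝ) (b := y) (by simpa using hy) v
  rw [h] at h2
  exact h2

theorem chartFrame_bijective {x₀ y : M} (hy : y ∈ (chartAt Plane x₀).source) :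
    Function.Bijective (chartFrame x₀ y) :=
  ⟨fun v w h ↦ by rw [← mfderiv_chartFrame hy v, h, mfderiv_chartFrame hy w],
    fun v ↦ ⟨_, chartFrame_mfderiv hy v⟩⟩

theorem inverse_mfderiv_extChartAt {x₀ y : M} (hy : y ∈ (chartAt Plane x₀).source) (v : Plane) :
    (mfderiv (𝓡 2) (𝓡 2) (extChartAt (𝓡 2) x₀) y).inverse v = chartFrame x₀ y v := by
  have h : (mfderiv (𝓡 2) (𝓡 2) (extChartAt (𝓡 2) x₀) y).IsInvertible :=
    isInvertible_mfderiv_extChartAt (by simpa using hy)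
  obtain ⟨e, he⟩ := h
  rw [← he, ContinuousLinearMap.inverse_equiv]
  apply e.injective
  have h2 := mfderiv_chartFrame hy v
  rw [← he] at h2
  exact (e.apply_symm_apply v).trans h2.symm

/-- Identifies the coordinate fields with the frame of the bundle trivialization, through which
smoothness of the metric coefficients is obtained. -/
theorem coordVector_eq_chartFrame {x₀ : M} {u : Plane} (hu : u ∈ (extChartAt (𝓡 2) x₀).target)
    (i : Fin 2) :
    coordVector x₀ u i =
      chartFrame x₀ ((extChartAt (𝓡 2) x₀).symm u) (EuclideanSpace.single i (1 : ℝ)) := by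
  have hy : (extChartAt (𝓡 2) x₀).symm u ∈ (chartAt Plane x₀).source := by
    simpa using (extChartAt (𝓡 2) x₀).map_target hu
  have h := TangentBundle.symmL_trivializationAt (I := 𝓡 2) hy
  rw [(extChartAt (𝓡 2) x₀).right_inv hu] at h
  unfold chartFrame coordVector
  rw [h, ModelWithCorners.range_eq_univ, mfderivWithin_univ]
  rfl
theorem velocity_eq_chartFrame {x₀ : M} {γ : ℝ → M} {t : ℝ}
    (hγ : MDifferentiableAt 𝓘(ℝ, ℝ) (𝓡 2) γ t) (ht : γ t ∈ (chartAt Plane x₀).source) :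
    velocity γ t = chartFrame x₀ (γ t) (deriv (fun s ↦ extChartAt (𝓡 2) x₀ (γ s)) t) := by
  have h1 : MDifferentiableAt (𝓡 2) (𝓡 2) (extChartAt (𝓡 2) x₀) (γ t) :=
    mdifferentiableAt_extChartAt ht
  have h2 : deriv (fun s ↦ extChartAt (𝓡 2) x₀ (γ s)) t =
      mfderiv (𝓡 2) (𝓡 2) (extChartAt (𝓡 2) x₀) (γ t) (velocity γ t) := by
    have h3 := mfderiv_comp t h1 hγ
    rw [mfderiv_eq_fderiv] at h3
    exact congrArg (fun L ↦ L (1 : ℝ)) h3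
  rw [h2, chartFrame_mfderiv ht]

theorem contDiffAt_chart_transition {x₀ x₁ : M} {y : M} (h₀ : y ∈ (chartAt Plane x₀).source)
    (h₁ : y ∈ (chartAt Plane x₁).source) :
    ContDiffAt ℝ ∞ (fun z ↦ extChartAt (𝓡 2) x₁ ((extChartAt (𝓡 2) x₀).symm z))
      (extChartAt (𝓡 2) x₀ y) := by
  have h : extChartAt (𝓡 2) x₀ y ∈
      ((extChartAt (𝓡 2) x₀).symm ≫ extChartAt (𝓡 2) x₁).source := by
    rw [PartialEquiv.trans_source'', PartialEquiv.symm_symm, PartialEquiv.symm_target]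
    exact mem_image_of_mem _ ⟨by simpa using h₀, by simpa using h₁⟩
  have := contDiffWithinAt_ext_coord_change (n := ∞) x₁ x₀ h
  simpa [contDiffWithinAt_univ] using! this

theorem chartFrame_eq_comp_transition {x₀ x₁ y : M} (h₀ : y ∈ (chartAt Plane x₀).source)
    (h₁ : y ∈ (chartAt Plane x₁).source) (v : Plane) :
    chartFrame x₀ y v = chartFrame x₁ y
      (fderiv ℝ (fun z ↦ extChartAt (𝓡 2) x₁ ((extChartAt (𝓡 2) x₀).symm z))
        (extChartAt (𝓡 2) x₀ y) v) := by
  obtain ⟨u, hu, rfl⟩ : ∃ u ∈ (extChartAt (𝓡 2) x₀).target, (extChartAt (𝓡 2) x₀).symm u = y :=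
    ⟨_, (extChartAt (𝓡 2) x₀).map_source (by simpa using h₀),
      (extChartAt (𝓡 2) x₀).left_inv (by simpa using h₀)⟩
  rw [(extChartAt (𝓡 2) x₀).right_inv hu]
  have h1 : MDifferentiableAt (𝓡 2) (𝓡 2) (extChartAt (𝓡 2) x₁) ((extChartAt (𝓡 2) x₀).symm u) :=
    mdifferentiableAt_extChartAt h₁
  have h2 : MDifferentiableAt (𝓡 2) (𝓡 2) (extChartAt (𝓡 2) x₀).symm u := by
    have := mdifferentiableWithinAt_extChartAt_symm (I := 𝓡 2) hu
    rwa [ModelWithCorners.range_eq_univ, mdifferentiableWithinAt_univ] at this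
  have h3 := mfderiv_comp u h1 h2
  rw [mfderiv_eq_fderiv] at h3
  have h4 := TangentBundle.symmL_trivializationAt (I := 𝓡 2) h₀
  rw [(extChartAt (𝓡 2) x₀).right_inv hu, ModelWithCorners.range_eq_univ, mfderivWithin_univ] at h4
  have h5 : fderiv ℝ (fun z ↦ extChartAt (𝓡 2) x₁ ((extChartAt (𝓡 2) x₀).symm z)) u v =
      mfderiv (𝓡 2) (𝓡 2) (extChartAt (𝓡 2) x₁) ((extChartAt (𝓡 2) x₀).symm u)
        (chartFrame x₀ ((extChartAt (𝓡 2) x₀).symm u) v) := by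
    refine (congrArg (fun L ↦ L v) h3).trans ?_
    unfold chartFrame
    rw [h4]
    rfl
  rw [h5, chartFrame_mfderiv h₁]

/-- Read in the trivialization around `x₀`, this section is the constant `v`. -/
theorem contMDiffOn_chartFrame (x₀ : M) (v : Plane) :
    ContMDiffOn (𝓡 2) ((𝓡 2).prod 𝓘(ℝ, Plane)) ∞
      (fun y ↦ (⟨y, chartFrame x₀ y v⟩ : TotalSpace Plane (TangentSpace (𝓡 2) : M → Type _)))
      (chartAt Plane x₀).source := by
  have h := (trivializationAt Plane (TangentSpace (𝓡 2) : M → Type _) x₀).contMDiffOn_section_baseSet_iff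
    (IB := 𝓡 2) (n := ∞) (s := fun y ↦ chartFrame x₀ y v)
  refine h.2 ((contMDiffOn_const (c := v)).congr fun y hy ↦ ?_)
  have h2 := (trivializationAt Plane (TangentSpace (𝓡 2) : M → Type _)
    x₀).continuousLinearMapAt_symmL (R := ℝ) (b := y) hy v
  exact (Trivialization.continuousLinearMapAt_apply_of_mem ℝ _ hy _).symm.trans h2

theorem contDiffAt_chart_comp {x₀ : M} {γ : ℝ → M} {t : ℝ}
    (hγ : ContMDiffAt 𝓘(ℝ, ℝ) (𝓡 2) 2 γ t) (ht : γ t ∈ (chartAt Plane x₀).source) :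
    ContDiffAt ℝ 2 (fun s ↦ extChartAt (𝓡 2) x₀ (γ s)) t := by
  have h := (contMDiffAt_extChartAt' (I := 𝓡 2) (n := 2) ht).comp t hγ
  exact contMDiffAt_iff_contDiffAt.1 h

end ChartFrame

/-! ### The metric and the Christoffel symbols in a chart -/

section Metric

variable {M : Type*} [TopologicalSpace M] [ChartedSpace Plane M]
  [RiemannianBundle (fun x : M ↦ TangentSpace (𝓡 2) x)]

/-- The Riemannian metric in the chart around `x₀`, as a bilinear form on the plane depending on
the coordinates `u`. -/
noncomputable def metricForm (x₀ : M) (u : Plane) : Plane →L[ℝ] Plane →L[ℝ] ℝ :=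
  ∑ i, ∑ j, metricMatrix x₀ u i j •
    (EuclideanSpace.proj i : Plane →L[ℝ] ℝ).smulRight (EuclideanSpace.proj j : Plane →L[ℝ] ℝ)

theorem metricForm_apply (x₀ : M) (u v w : Plane) :
    metricForm x₀ u v w = ∑ i, ∑ j, metricMatrix x₀ u i j * (v i * w j) := by
  simp [metricForm]

theorem metricMatrix_symm (x₀ : M) (u : Plane) (i j : Fin 2) :
    metricMatrix x₀ u i j = metricMatrix x₀ u j i := by
  simp only [metricMatrix, Matrix.of_apply]
  exact real_inner_comm _ _

theorem metricForm_symm (x₀ : M) (u v w : Plane) :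
    metricForm x₀ u v w = metricForm x₀ u w v := by
  simp only [metricForm_apply, Fin.sum_univ_two, metricMatrix_symm x₀ u 1 0]
  ring

theorem fderiv_metricForm_apply {x₀ : M} {u : Plane} (hG : DifferentiableAt ℝ (metricForm x₀) u)
    (h : ∀ i j, DifferentiableAt ℝ (fun v ↦ metricMatrix x₀ v i j) u) (k : Fin 2) (v w : Plane) :
    fderiv ℝ (metricForm x₀) u (EuclideanSpace.single k 1) v w =
      ∑ i, ∑ j, partialDeriv k (fun v ↦ metricMatrix x₀ v i j) u * (v i * w j) := by
  have b1 := hG.hasFDerivAt.clm_apply (hasFDerivAt_const v u)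
  have a1 := b1.clm_apply (hasFDerivAt_const w u)
  have h1 : HasFDerivAt (fun u ↦ ∑ i, ∑ j, metricMatrix x₀ u i j * (v i * w j)) _ u :=
    HasFDerivAt.fun_sum (u := Finset.univ) fun i _ ↦
      HasFDerivAt.fun_sum (u := Finset.univ) fun j _ ↦
        ((h i j).hasFDerivAt.mul_const (v i * w j))
  have h2 := a1.congr_of_eventuallyEq
    (Eventually.of_forall fun z ↦ (metricForm_apply x₀ z v w).symm)
  have h3 := congrArg (fun L ↦ L (EuclideanSpace.single k 1)) (h2.unique h1)
  simp at h3
  rw [h3]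
  simp [partialDeriv, mul_comm]

variable [IsManifold (𝓡 2) ∞ M]

theorem metricForm_eq_inner {x₀ y : M} (hy : y ∈ (chartAt Plane x₀).source) (v w : Plane) :
    metricForm x₀ (extChartAt (𝓡 2) x₀ y) v w =
      inner ℝ (chartFrame x₀ y v) (chartFrame x₀ y w) := by
  obtain ⟨u, hu, rfl⟩ : ∃ u ∈ (extChartAt (𝓡 2) x₀).target, (extChartAt (𝓡 2) x₀).symm u = y :=
    ⟨_, (extChartAt (𝓡 2) x₀).map_source (by simpa using hy),
      (extChartAt (𝓡 2) x₀).left_inv (by simpa using hy)⟩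
  rw [(extChartAt (𝓡 2) x₀).right_inv hu, metricForm_apply]
  have hv : ∀ v : Plane, v = ∑ i, v i • EuclideanSpace.single i (1 : ℝ) := by
    intro v
    ext i
    fin_cases i <;> simp
  conv_rhs => rw [hv v, hv w]
  simp only [map_sum, map_smul, sum_inner, inner_sum, real_inner_smul_left, real_inner_smul_right]
  rw [Finset.sum_comm]
  refine Finset.sum_congr rfl fun i _ ↦ Finset.sum_congr rfl fun j _ ↦ ?_
  rw [metricMatrix, Matrix.of_apply, coordVector_eq_chartFrame hu, coordVector_eq_chartFrame hu]
  ring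

theorem metricForm_self_pos {x₀ : M} {u : Plane} (hu : u ∈ (extChartAt (𝓡 2) x₀).target)
    {v : Plane} (hv : v ≠ 0) : 0 < metricForm x₀ u v v := by
  have hy : (extChartAt (𝓡 2) x₀).symm u ∈ (chartAt Plane x₀).source := by
    simpa using (extChartAt (𝓡 2) x₀).map_target hu
  have h := metricForm_eq_inner hy v v
  rw [(extChartAt (𝓡 2) x₀).right_inv hu] at h
  rw [h, real_inner_self_pos]
  intro h0
  exact hv ((chartFrame_bijective hy).1 (h0.trans (map_zero _).symm))

theorem metricMatrix_det_pos {x₀ : M} {u : Plane} (hu : u ∈ (extChartAt (𝓡 2) x₀).target) :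
    0 < (metricMatrix x₀ u).det := by
  set a := metricMatrix x₀ u 0 0 with ha
  set b := metricMatrix x₀ u 0 1 with hb
  have hba : metricMatrix x₀ u 1 0 = b := metricMatrix_symm x₀ u 1 0
  have h0 : 0 < a := by
    have := metricForm_self_pos hu (v := EuclideanSpace.single 0 1) (by simp)
    simpa [metricForm_apply] using this
  -- The vector `(-b, a)` is orthogonal to the first coordinate vector, and its squared length is
  -- `a` times the determinant.
  have h1 : 0 < metricForm x₀ u (WithLp.toLp 2 ![-b, a]) (WithLp.toLp 2 ![-b, a]) :=
    metricForm_self_pos hu fun h ↦ by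
      have := congrFun (congrArg WithLp.ofLp h) 1
      simp at this
      exact h0.ne' this
  simp only [metricForm_apply, Fin.sum_univ_two, hba, ← ha, ← hb] at h1
  simp at h1
  rw [Matrix.det_fin_two, hba, ← ha, ← hb]
  have : 0 < a * (a * metricMatrix x₀ u 1 1 - b * b) := by linarith
  exact pos_of_mul_pos_right this h0.le

variable [IsContMDiffRiemannianBundle (𝓡 2) ∞ Plane (fun x : M ↦ TangentSpace (𝓡 2) x)]

theorem contMDiffOn_inner_chartFrame (x₀ : M) (v w : Plane) :
    ContMDiffOn (𝓡 2) 𝓘(ℝ, ℝ) ∞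
      (fun y ↦ (inner ℝ (chartFrame x₀ y v) (chartFrame x₀ y w) : ℝ)) (chartAt Plane x₀).source :=
  (contMDiffOn_chartFrame x₀ v).inner_bundle (contMDiffOn_chartFrame x₀ w)

theorem contDiffOn_metricMatrix (x₀ : M) (i j : Fin 2) :
    ContDiffOn ℝ ∞ (fun u ↦ metricMatrix x₀ u i j) (extChartAt (𝓡 2) x₀).target := by
  have h := (contMDiffOn_inner_chartFrame x₀ (EuclideanSpace.single i 1)
    (EuclideanSpace.single j 1)).comp (contMDiffOn_extChartAt_symm (I := 𝓡 2) (n := ∞) x₀)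
    (fun u hu ↦ by simpa using (extChartAt (𝓡 2) x₀).map_target hu)
  refine h.contDiffOn.congr fun u hu ↦ ?_
  rw [metricMatrix, Matrix.of_apply, coordVector_eq_chartFrame hu, coordVector_eq_chartFrame hu]
  rfl

theorem contDiffOn_metricForm (x₀ : M) :
    ContDiffOn ℝ ∞ (metricForm x₀) (extChartAt (𝓡 2) x₀).target :=
  contDiffOn_clm_apply.2 fun v ↦ contDiffOn_clm_apply.2 fun w ↦ by
    simp only [metricForm_apply]
    exact ContDiffOn.sum fun i _ ↦ ContDiffOn.sum fun j _ ↦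
      (contDiffOn_metricMatrix x₀ i j).mul contDiffOn_const

theorem contDiffAt_metricForm {x₀ : M} {u : Plane} (hu : u ∈ (extChartAt (𝓡 2) x₀).target) :
    ContDiffAt ℝ ∞ (metricForm x₀) u :=
  (contDiffOn_metricForm x₀).contDiffAt ((isOpen_extChartAt_target x₀).mem_nhds hu)

theorem differentiableAt_metricForm {x₀ : M} {u : Plane}
    (hu : u ∈ (extChartAt (𝓡 2) x₀).target) : DifferentiableAt ℝ (metricForm x₀) u := by
  have h := (contDiffAt_metricForm hu).differentiableAt (by simp)
  exact h

/-- Lowering an index removes the inverse of the metric from the Christoffel symbols. -/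
theorem metricForm_add_christoffel {x₀ : M} {u : Plane}
    (hu' : u ∈ (extChartAt (𝓡 2) x₀).target) (a v w : Plane) :
    metricForm x₀ u
      (WithLp.toLp 2 fun k ↦ a k + ∑ i, ∑ j, christoffel x₀ k i j u * v i * v j) w =
      fderiv ℝ (metricForm x₀) u v v w + metricForm x₀ u a w
        - 1 / 2 * fderiv ℝ (metricForm x₀) u w v v := by
  have hdG := differentiableAt_metricForm hu'
  have hdg : ∀ i j, DifferentiableAt ℝ (fun v ↦ metricMatrix x₀ v i j) u := fun i j ↦
    ((contDiffOn_metricMatrix x₀ i j).contDiffAt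
      ((isOpen_extChartAt_target x₀).mem_nhds hu')).differentiableAt (by simp)
  have hfd : ∀ h p q : Plane, fderiv ℝ (metricForm x₀) u h p q =
      ∑ k, h k * ∑ i, ∑ j, partialDeriv k (fun v ↦ metricMatrix x₀ v i j) u * (p i * q j) := by
    intro h p q
    have hh : h = ∑ k, h k • EuclideanSpace.single k (1 : ℝ) := by
      ext i
      fin_cases i <;> simp
    conv_lhs => rw [hh]
    rw [Fin.sum_univ_two, (fderiv ℝ (metricForm x₀) u).map_add,
      (fderiv ℝ (metricForm x₀) u).map_smul, (fderiv ℝ (metricForm x₀) u).map_smul]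
    simp only [add_apply, smul_apply, smul_eq_mul]
    rw [fderiv_metricForm_apply hdG hdg, fderiv_metricForm_apply hdG hdg]
    simp only [Fin.sum_univ_two]
  have hsymm : ∀ k, partialDeriv k (fun v ↦ metricMatrix x₀ v 1 0) u =
      partialDeriv k (fun v ↦ metricMatrix x₀ v 0 1) u := by
    intro k
    congr 1
    funext v
    exact metricMatrix_symm x₀ v 1 0
  have hg := metricMatrix_symm x₀ u 1 0
  have hdet := (metricMatrix_det_pos hu').ne'
  rw [Matrix.det_fin_two, hg, ← sq] at hdet
  have hinv : ∀ k l, (metricMatrix x₀ u)⁻¹ k l = (metricMatrix x₀ u 0 0 * metricMatrix x₀ u 1 1 -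
      metricMatrix x₀ u 0 1 ^ 2)⁻¹ *
      !![metricMatrix x₀ u 1 1, -metricMatrix x₀ u 0 1;
        -metricMatrix x₀ u 0 1, metricMatrix x₀ u 0 0] k l := by
    intro k l
    rw [Matrix.inv_def, Matrix.adjugate_fin_two, Matrix.det_fin_two, hg, ← sq, Ring.inverse_eq_inv,
      Matrix.smul_apply, smul_eq_mul]
  rw [hfd, hfd]
  simp only [metricForm_apply, christoffel, hinv, Fin.sum_univ_two, hsymm, hg]
  -- What remains is a rational identity in the three metric coefficients and their partial
  -- derivatives, with the determinant as only denominator.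
  generalize metricMatrix x₀ u 0 0 = g00 at *
  generalize metricMatrix x₀ u 0 1 = g01 at *
  generalize metricMatrix x₀ u 1 1 = g11 at *
  simp
  field_simp
  ring

theorem metricForm_accelerationCoord {x₀ : M} {γ : ℝ → M} {t : ℝ}
    (ht : γ t ∈ (chartAt Plane x₀).source) (w : Plane) :
    metricForm x₀ (extChartAt (𝓡 2) x₀ (γ t)) (accelerationCoord x₀ γ t) w =
      loweredAcceleration (metricForm x₀) (fun s ↦ extChartAt (𝓡 2) x₀ (γ s)) t w :=
  metricForm_add_christoffel ((extChartAt (𝓡 2) x₀).map_source (by simpa using ht)) _ _ w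

end Metric

/-! ### Area form, orientation and rotation -/

theorem areaForm_basis_pos_iff {E : Type*} [NormedAddCommGroup E] [InnerProductSpace ℝ E]
    [Fact (Module.finrank ℝ E = 2)] (o : Orientation ℝ E (Fin 2)) (b : Module.Basis (Fin 2) ℝ E) :
    0 < o.areaForm (b 0) (b 1) ↔ o = b.orientation := by
  have he := o.finOrthonormalBasis_orientation two_pos Fact.out
  -- The area form is the determinant relative to any orthonormal basis of orientation `o`.
  have h : o.areaForm (b 0) (b 1) = (o.finOrthonormalBasis two_pos Fact.out).toBasis.det b := by
    rw [o.areaForm_to_volumeForm, o.volumeForm_robust _ he]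
    congr 1
    funext i
    fin_cases i <;> rfl
  rw [h, ← Module.Basis.orientation_eq_iff_det_pos, he]

section Rotation

variable {M : Type*} [TopologicalSpace M] [ChartedSpace Plane M] [IsManifold (𝓡 2) ∞ M]
  [RiemannianBundle (fun x : M ↦ TangentSpace (𝓡 2) x)]

theorem inner_rotation90 (o : SurfaceOrientation M) (y : M) (v w : TangentSpace (𝓡 2) y) :
    inner ℝ (rotation90 o y v) w = (o.at_ y).areaForm v w :=
  (o.at_ y).inner_rightAngleRotation_left v w

theorem inner_rotation90_chartFrame (o : SurfaceOrientation M) (x₀ y : M) (v w : Plane) :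
    inner ℝ (rotation90 o y (chartFrame x₀ y v)) (chartFrame x₀ y w) =
      (o.at_ y).areaForm (chartFrame x₀ y (EuclideanSpace.single 0 1))
        (chartFrame x₀ y (EuclideanSpace.single 1 1)) * (v 0 * w 1 - v 1 * w 0) := by
  have hv : ∀ v : Plane, v = ∑ i, v i • EuclideanSpace.single i (1 : ℝ) := by
    intro v
    ext i
    fin_cases i <;> simp
  rw [inner_rotation90]
  conv_lhs => rw [hv v, hv w]
  simp only [Fin.sum_univ_two, map_add, map_smul, LinearMap.add_apply, LinearMap.smul_apply,
    smul_eq_mul, (o.at_ y).areaForm_apply_self]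
  rw [(o.at_ y).areaForm_swap (chartFrame x₀ y (EuclideanSpace.single 1 1))]
  ring

/-- Lagrange's identity `⟨v, w⟩² + area(v, w)² = ‖v‖² ‖w‖²`: the squared area is the Gram
determinant. This fixes the area form in the chart up to sign. -/
theorem areaForm_chartFrame_sq (o : SurfaceOrientation M) {x₀ y : M}
    (hy : y ∈ (chartAt Plane x₀).source) :
    (o.at_ y).areaForm (chartFrame x₀ y (EuclideanSpace.single 0 1))
        (chartFrame x₀ y (EuclideanSpace.single 1 1)) ^ 2 =
      (metricMatrix x₀ (extChartAt (𝓡 2) x₀ y)).det := by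
  have hg : ∀ i j, metricMatrix x₀ (extChartAt (𝓡 2) x₀ y) i j =
      inner ℝ (chartFrame x₀ y (EuclideanSpace.single i 1))
        (chartFrame x₀ y (EuclideanSpace.single j 1)) := by
    intro i j
    rw [← metricForm_eq_inner hy, metricForm_apply]
    fin_cases i <;> fin_cases j <;> simp
  have h := (o.at_ y).inner_sq_add_areaForm_sq (chartFrame x₀ y (EuclideanSpace.single 0 1))
    (chartFrame x₀ y (EuclideanSpace.single 1 1))
  rw [← real_inner_self_eq_norm_sq, ← real_inner_self_eq_norm_sq, ← hg, ← hg, ← hg] at h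
  rw [Matrix.det_fin_two, metricMatrix_symm x₀ _ 1 0]
  linarith

/-- Near `x₀` the area form is, in the chart around `x₀`, a constant multiple of
`√(det g) du⁰ ∧ du¹`. -/
theorem exists_eventually_areaForm_eq (o : SurfaceOrientation M) (x₀ : M) :
    ∃ ε : ℝ, ∀ᶠ y in 𝓝 x₀,
      (o.at_ y).areaForm (chartFrame x₀ y (EuclideanSpace.single 0 1))
        (chartFrame x₀ y (EuclideanSpace.single 1 1)) =
      ε * √(metricMatrix x₀ (extChartAt (𝓡 2) x₀ y)).det := by
  obtain ⟨o₀, ho₀⟩ := o.locally_constant x₀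
  -- The right-hand side of the equivalence does not depend on `y`, so the sign is constant near
  -- `x₀`. Charts need not be positively oriented, hence the two cases `ε = 1` and `ε = -1`.
  have key : ∀ᶠ y in 𝓝 x₀, y ∈ (chartAt Plane x₀).source ∧
      (0 < (o.at_ y).areaForm (chartFrame x₀ y (EuclideanSpace.single 0 1))
        (chartFrame x₀ y (EuclideanSpace.single 1 1)) ↔
        o₀ = (EuclideanSpace.basisFun (Fin 2) ℝ).toBasis.orientation) := by
    filter_upwards [ho₀, chart_source_mem_nhds Plane x₀] with y hy hys
    refine ⟨hys, ?_⟩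
    set e := ((trivializationAt Plane (TangentSpace (𝓡 2) : M → Type _) x₀).continuousLinearEquivAt
      ℝ y hys).toLinearEquiv with he
    have hb := areaForm_basis_pos_iff (o.at_ y)
      ((EuclideanSpace.basisFun (Fin 2) ℝ).toBasis.map e.symm)
    have hb' : ∀ i, (EuclideanSpace.basisFun (Fin 2) ℝ).toBasis.map e.symm i =
        chartFrame x₀ y (EuclideanSpace.single i 1) := by
      intro i
      rw [Module.Basis.map_apply, OrthonormalBasis.coe_toBasis, EuclideanSpace.basisFun_apply]
      exact congrFun ((trivializationAt Plane (TangentSpace (𝓡 2) : M → Type _)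
        x₀).symm_continuousLinearEquivAt_eq (R := ℝ) hys) _
    rw [hb', hb'] at hb
    rw [hb, Module.Basis.orientation_map, ← hy hys]
    refine ⟨fun h ↦ ?_, fun h ↦ ?_⟩
    · rw [h]
      exact (Orientation.map (Fin 2) e).apply_symm_apply _
    · rw [← h]
      exact ((Orientation.map (Fin 2) e).symm_apply_apply _).symm
  by_cases h : o₀ = (EuclideanSpace.basisFun (Fin 2) ℝ).toBasis.orientation
  · refine ⟨1, key.mono fun y hy ↦ ?_⟩
    rw [← areaForm_chartFrame_sq o hy.1, Real.sqrt_sq (hy.2.2 h).le, one_mul]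
  · refine ⟨-1, key.mono fun y hy ↦ ?_⟩
    rw [← areaForm_chartFrame_sq o hy.1, Real.sqrt_sq_eq_abs,
      abs_of_nonpos (not_lt.1 fun h0 ↦ h (hy.2.1 h0))]
    ring

end Rotation

/-! ### The equation in an arbitrary chart -/

section Equation

variable {M : Type*} [TopologicalSpace M] [ChartedSpace Plane M] [IsManifold (𝓡 2) ∞ M]
  [RiemannianBundle (fun x : M ↦ TangentSpace (𝓡 2) x)]
  [IsContMDiffRiemannianBundle (𝓡 2) ∞ Plane (fun x : M ↦ TangentSpace (𝓡 2) x)]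

/-- The equation of the curve `γ` at time `t`, written in the chart around `x₀`. -/
def EquationInChart (o : SurfaceOrientation M) (κ : M → ℝ) (x₀ : M) (γ : ℝ → M) (t : ℝ) : Prop :=
  ∀ w : Plane, loweredAcceleration (metricForm x₀) (fun s ↦ extChartAt (𝓡 2) x₀ (γ s)) t w =
    κ (γ t) * inner ℝ (rotation90 o (γ t) (velocity γ t)) (chartFrame x₀ (γ t) w)

/-- Two tangent vectors are equal once their inner products with the coordinate frame agree, since
the frame map is onto; lowering the index turns these products into the chart expression. -/
theorem covariantAcceleration_eq_iff (o : SurfaceOrientation M) (κ : M → ℝ) (γ : ℝ → M) (t : ℝ) :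
    covariantAcceleration γ t = κ (γ t) • rotation90 o (γ t) (velocity γ t) ↔
      EquationInChart o κ (γ t) γ t := by
  have hs := mem_chart_source Plane (γ t)
  have h : covariantAcceleration γ t = chartFrame (γ t) (γ t) (accelerationCoord (γ t) γ t) :=
    inverse_mfderiv_extChartAt hs _
  have h2 : EquationInChart o κ (γ t) γ t ↔ ∀ w, inner ℝ (covariantAcceleration γ t)
      (chartFrame (γ t) (γ t) w) = inner ℝ (κ (γ t) • rotation90 o (γ t) (velocity γ t))
      (chartFrame (γ t) (γ t) w) := by
    refine forall_congr' fun w ↦ ?_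
    rw [← metricForm_accelerationCoord hs, metricForm_eq_inner hs, h, real_inner_smul_left]
  rw [h2]
  refine ⟨fun h3 w ↦ by rw [h3], fun h3 ↦ ext_inner_right ℝ fun x ↦ ?_⟩
  obtain ⟨w, rfl⟩ := (chartFrame_bijective hs).2 x
  exact h3 w

/-- The transition map is an isometry between the two coordinate metrics, so the lowered
acceleration is natural under it. This frees the equation from the moving chart centred at `γ t`. -/
theorem EquationInChart.change {o : SurfaceOrientation M} {κ : M → ℝ} {x₀ x₁ : M} {γ : ℝ → M}
    {t : ℝ} (h : EquationInChart o κ x₁ γ t) (hγ : ContMDiffAt 𝓘(ℝ, ℝ) (𝓡 2) 2 γ t)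
    (h₀ : γ t ∈ (chartAt Plane x₀).source) (h₁ : γ t ∈ (chartAt Plane x₁).source) :
    EquationInChart o κ x₀ γ t := by
  intro w
  set c : ℝ → Plane := fun s ↦ extChartAt (𝓡 2) x₀ (γ s) with hc
  set τ : Plane → Plane := fun z ↦ extChartAt (𝓡 2) x₁ ((extChartAt (𝓡 2) x₀).symm z) with hτ
  have hcu : c t ∈ (extChartAt (𝓡 2) x₀).target :=
    (extChartAt (𝓡 2) x₀).map_source (by simpa using h₀)
  have hinv : (extChartAt (𝓡 2) x₀).symm (c t) = γ t :=
    (extChartAt (𝓡 2) x₀).left_inv (by simpa using h₀)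
  have hτct : τ (c t) = extChartAt (𝓡 2) x₁ (γ t) := by simp only [hτ]; rw [hinv]
  have hτt : τ (c t) ∈ (extChartAt (𝓡 2) x₁).target := by
    rw [hτct]
    exact (extChartAt (𝓡 2) x₁).map_source (by simpa using h₁)
  have hpull : ∀ᶠ z in 𝓝 (c t), ∀ v w, metricForm x₀ z v w =
      metricForm x₁ (τ z) (fderiv ℝ τ z v) (fderiv ℝ τ z w) := by
    have hcont : ContinuousAt (extChartAt (𝓡 2) x₀).symm (c t) :=
      continuousAt_extChartAt_symm'' hcu
    filter_upwards [(isOpen_extChartAt_target x₀).mem_nhds hcu,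
      hcont.preimage_mem_nhds ((chartAt Plane x₁).open_source.mem_nhds (by rw [hinv]; exact h₁))]
      with z hz hz1 v w
    have hz0 : (extChartAt (𝓡 2) x₀).symm z ∈ (chartAt Plane x₀).source := by
      simpa using (extChartAt (𝓡 2) x₀).map_target hz
    have e0 := metricForm_eq_inner hz0 v w
    rw [(extChartAt (𝓡 2) x₀).right_inv hz] at e0
    rw [e0, chartFrame_eq_comp_transition hz0 hz1 v, chartFrame_eq_comp_transition hz0 hz1 w,
      ← metricForm_eq_inner hz1, (extChartAt (𝓡 2) x₀).right_inv hz]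
  have hτd : ContDiffAt ℝ 2 τ (c t) :=
    (contDiffAt_chart_transition h₀ h₁).of_le (by norm_cast)
  rw [loweredAcceleration_comp hτd (contDiffAt_chart_comp hγ h₀) (differentiableAt_metricForm hcu)
    (differentiableAt_metricForm hτt) hpull (fun v w ↦ metricForm_symm x₁ _ v w) w]
  have hcomp : τ ∘ c =ᶠ[𝓝 t] fun s ↦ extChartAt (𝓡 2) x₁ (γ s) := by
    filter_upwards [hγ.continuousAt.preimage_mem_nhds
      ((chartAt Plane x₀).open_source.mem_nhds h₀)] with s hs
    simp only [hτ, hc, Function.comp_apply]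
    rw [(extChartAt (𝓡 2) x₀).left_inv (by simpa using hs)]
  have h3 : loweredAcceleration (metricForm x₁) (τ ∘ c) t =
      loweredAcceleration (metricForm x₁) (fun s ↦ extChartAt (𝓡 2) x₁ (γ s)) t := by
    funext w
    simp only [loweredAcceleration]
    rw [hcomp.deriv_eq, hcomp.deriv.deriv_eq, hcomp.self_of_nhds]
  rw [h3, h, chartFrame_eq_comp_transition h₀ h₁ w]

end Equation

/-! ### The equivalent first-order system and its smoothness -/

section Field

variable {M : Type*} [TopologicalSpace M] [ChartedSpace Plane M]
  [RiemannianBundle (fun x : M ↦ TangentSpace (𝓡 2) x)]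

/-- The lowered second derivative prescribed by the equation at the point `u` with velocity `v`,
in the chart around `x₀`, if the area form is `ε √(det g) du⁰ ∧ du¹`. -/
noncomputable def forceForm (κ : M → ℝ) (ε : ℝ) (x₀ : M) (u v w : Plane) : ℝ :=
  κ ((extChartAt (𝓡 2) x₀).symm u) * (ε * √(metricMatrix x₀ u).det * (v 0 * w 1 - v 1 * w 0))
    - fderiv ℝ (metricForm x₀) u v v w + 1 / 2 * fderiv ℝ (metricForm x₀) u w v v

/-- The second derivative prescribed by the equation in the chart around `x₀`, as a function of
position and velocity. -/
noncomputable def accelerationField (κ : M → ℝ) (ε : ℝ) (x₀ : M) (z : Plane × Plane) : Plane :=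
  WithLp.toLp 2 fun k ↦ ∑ l, (metricMatrix x₀ z.1)⁻¹ k l *
    forceForm κ ε x₀ z.1 z.2 (EuclideanSpace.single l 1)

/-- The first-order system equivalent to the equation in the chart around `x₀`. -/
noncomputable def phaseField (κ : M → ℝ) (ε : ℝ) (x₀ : M) (z : Plane × Plane) : Plane × Plane :=
  (z.2, accelerationField κ ε x₀ z)

theorem forceForm_eq_sum (κ : M → ℝ) (ε : ℝ) (x₀ : M) (u v w : Plane) :
    forceForm κ ε x₀ u v w = ∑ l, w l * forceForm κ ε x₀ u v (EuclideanSpace.single l 1) := by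
  have hw : w = w 0 • EuclideanSpace.single 0 (1 : ℝ) + w 1 • EuclideanSpace.single 1 (1 : ℝ) := by
    ext i
    fin_cases i <;> simp
  have h1 : fderiv ℝ (metricForm x₀) u w =
      w 0 • fderiv ℝ (metricForm x₀) u (EuclideanSpace.single 0 1) +
      w 1 • fderiv ℝ (metricForm x₀) u (EuclideanSpace.single 1 1) := by
    conv_lhs => rw [hw]
    rw [(fderiv ℝ (metricForm x₀) u).map_add, (fderiv ℝ (metricForm x₀) u).map_smul,
      (fderiv ℝ (metricForm x₀) u).map_smul]
  have h2 : fderiv ℝ (metricForm x₀) u v v w =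
      w 0 * fderiv ℝ (metricForm x₀) u v v (EuclideanSpace.single 0 1) +
      w 1 * fderiv ℝ (metricForm x₀) u v v (EuclideanSpace.single 1 1) := by
    conv_lhs => rw [hw]
    rw [map_add, map_smul, map_smul, smul_eq_mul, smul_eq_mul]
  simp only [forceForm, Fin.sum_univ_two]
  rw [h1, h2]
  simp only [add_apply, smul_apply, smul_eq_mul]
  simp
  ring

theorem metricForm_toLp_inv {x₀ : M} {u : Plane} (hdet : (metricMatrix x₀ u).det ≠ 0)
    (r : Fin 2 → ℝ) (w : Plane) :
    metricForm x₀ u (WithLp.toLp 2 fun k ↦ ∑ l, (metricMatrix x₀ u)⁻¹ k l * r l) w =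
      ∑ l, w l * r l := by
  have h : metricMatrix x₀ u * (metricMatrix x₀ u)⁻¹ = 1 :=
    Matrix.mul_nonsing_inv _ (isUnit_iff_ne_zero.2 hdet)
  have hij : ∀ i j, metricMatrix x₀ u 0 i * (metricMatrix x₀ u)⁻¹ 0 j +
      metricMatrix x₀ u 1 i * (metricMatrix x₀ u)⁻¹ 1 j = if i = j then 1 else 0 := by
    intro i j
    have := congrFun (congrFun h i) j
    rw [Matrix.mul_apply, Fin.sum_univ_two, Matrix.one_apply] at this
    rw [metricMatrix_symm x₀ u 0 i, metricMatrix_symm x₀ u 1 i]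
    exact this
  have h00 := hij 0 0
  have h01 := hij 0 1
  have h10 := hij 1 0
  have h11 := hij 1 1
  simp only [metricForm_apply, Fin.sum_univ_two]
  simp at h00 h01 h10 h11
  linear_combination (w 0 * r 0) * h00 + (w 0 * r 1) * h01 + (w 1 * r 0) * h10 + (w 1 * r 1) * h11

variable [IsManifold (𝓡 2) ∞ M]

theorem metricForm_left_cancel {x₀ : M} {u : Plane} (hu : u ∈ (extChartAt (𝓡 2) x₀).target)
    {a b : Plane} (h : ∀ w, metricForm x₀ u a w = metricForm x₀ u b w) : a = b := by
  by_contra hne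
  have h1 := metricForm_self_pos hu (sub_ne_zero.2 hne)
  rw [(metricForm x₀ u).map_sub, sub_apply, h, sub_self] at h1
  exact lt_irrefl _ h1

theorem metricForm_accelerationField (κ : M → ℝ) (ε : ℝ) {x₀ : M} {u : Plane}
    (hu : u ∈ (extChartAt (𝓡 2) x₀).target) (v w : Plane) :
    metricForm x₀ u (accelerationField κ ε x₀ (u, v)) w = forceForm κ ε x₀ u v w := by
  rw [forceForm_eq_sum]
  exact metricForm_toLp_inv (metricMatrix_det_pos hu).ne' _ w

/-- Nondegeneracy of the metric allows the lowered equation to be solved for the second derivative.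
The hypothesis on `ε` replaces the orientation by an explicit smooth expression. -/
theorem equationInChart_iff {o : SurfaceOrientation M} {κ : M → ℝ} {ε : ℝ} {x₀ : M} {γ : ℝ → M}
    {t : ℝ} (hγ : ContMDiffAt 𝓘(ℝ, ℝ) (𝓡 2) 2 γ t) (ht : γ t ∈ (chartAt Plane x₀).source)
    (hε : (o.at_ (γ t)).areaForm (chartFrame x₀ (γ t) (EuclideanSpace.single 0 1))
        (chartFrame x₀ (γ t) (EuclideanSpace.single 1 1)) =
      ε * √(metricMatrix x₀ (extChartAt (𝓡 2) x₀ (γ t))).det) :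
    EquationInChart o κ x₀ γ t ↔
      deriv (deriv fun s ↦ extChartAt (𝓡 2) x₀ (γ s)) t = accelerationField κ ε x₀
        (extChartAt (𝓡 2) x₀ (γ t), deriv (fun s ↦ extChartAt (𝓡 2) x₀ (γ s)) t) := by
  have hu : extChartAt (𝓡 2) x₀ (γ t) ∈ (extChartAt (𝓡 2) x₀).target :=
    (extChartAt (𝓡 2) x₀).map_source (by simpa using ht)
  have hinv : (extChartAt (𝓡 2) x₀).symm (extChartAt (𝓡 2) x₀ (γ t)) = γ t :=
    (extChartAt (𝓡 2) x₀).left_inv (by simpa using ht)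
  have key : EquationInChart o κ x₀ γ t ↔ ∀ w, metricForm x₀ (extChartAt (𝓡 2) x₀ (γ t))
      (deriv (deriv fun s ↦ extChartAt (𝓡 2) x₀ (γ s)) t) w =
      metricForm x₀ (extChartAt (𝓡 2) x₀ (γ t)) (accelerationField κ ε x₀
        (extChartAt (𝓡 2) x₀ (γ t), deriv (fun s ↦ extChartAt (𝓡 2) x₀ (γ s)) t)) w := by
    refine forall_congr' fun w ↦ ?_
    rw [metricForm_accelerationField κ ε hu, forceForm, hinv,
      velocity_eq_chartFrame (hγ.mdifferentiableAt two_ne_zero) ht, inner_rotation90_chartFrame, hε,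
      loweredAcceleration]
    constructor <;> intro h <;> linarith
  rw [key]
  exact ⟨metricForm_left_cancel hu, fun h w ↦ by rw [h]⟩

variable [IsContMDiffRiemannianBundle (𝓡 2) ∞ Plane (fun x : M ↦ TangentSpace (𝓡 2) x)]

theorem contDiffOn_metricMatrix_det (x₀ : M) :
    ContDiffOn ℝ ∞ (fun u ↦ (metricMatrix x₀ u).det) (extChartAt (𝓡 2) x₀).target := by
  simp only [Matrix.det_fin_two]
  exact ((contDiffOn_metricMatrix x₀ 0 0).mul (contDiffOn_metricMatrix x₀ 1 1)).sub
    ((contDiffOn_metricMatrix x₀ 0 1).mul (contDiffOn_metricMatrix x₀ 1 0))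

theorem contDiffOn_metricMatrix_inv (x₀ : M) (k l : Fin 2) :
    ContDiffOn ℝ ∞ (fun u ↦ (metricMatrix x₀ u)⁻¹ k l) (extChartAt (𝓡 2) x₀).target := by
  have h : (fun u ↦ (metricMatrix x₀ u)⁻¹ k l) = fun u ↦ ((metricMatrix x₀ u).det)⁻¹ *
      !![metricMatrix x₀ u 1 1, -metricMatrix x₀ u 0 1;
        -metricMatrix x₀ u 1 0, metricMatrix x₀ u 0 0] k l := by
    funext u
    rw [Matrix.inv_def, Matrix.adjugate_fin_two, Ring.inverse_eq_inv, Matrix.smul_apply,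
      smul_eq_mul]
  rw [h]
  refine ((contDiffOn_metricMatrix_det x₀).inv fun u hu ↦ (metricMatrix_det_pos hu).ne').mul ?_
  fin_cases k <;> fin_cases l
  · exact contDiffOn_metricMatrix x₀ 1 1
  · exact (contDiffOn_metricMatrix x₀ 0 1).neg
  · exact (contDiffOn_metricMatrix x₀ 1 0).neg
  · exact contDiffOn_metricMatrix x₀ 0 0

theorem contDiffOn_fderiv_metricForm (x₀ : M) {f g h : Plane × Plane → Plane}
    (hf : ContDiff ℝ ∞ f) (hg : ContDiff ℝ ∞ g) (hh : ContDiff ℝ ∞ h) :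
    ContDiffOn ℝ ∞ (fun z : Plane × Plane ↦ fderiv ℝ (metricForm x₀) z.1 (f z) (g z) (h z))
      ((extChartAt (𝓡 2) x₀).target ×ˢ univ) := by
  have h1 := (contDiffOn_metricForm x₀).fderiv_of_isOpen (m := ∞) (isOpen_extChartAt_target x₀)
    (by simp)
  have h2 := h1.comp (t := (extChartAt (𝓡 2) x₀).target) (s := (extChartAt (𝓡 2) x₀).target ×ˢ univ)
    (contDiff_fst (𝕜 := ℝ) (E := Plane) (F := Plane)).contDiffOn (fun z hz ↦ hz.1)
  have h3 := h2.clm_apply hf.contDiffOn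
  have h4 := h3.clm_apply hg.contDiffOn
  exact h4.clm_apply hh.contDiffOn

theorem contDiffOn_forceForm {κ : M → ℝ} (hκ : ContMDiff (𝓡 2) 𝓘(ℝ, ℝ) ∞ κ) (ε : ℝ) (x₀ : M)
    (w : Plane) :
    ContDiffOn ℝ ∞ (fun z : Plane × Plane ↦ forceForm κ ε x₀ z.1 z.2 w)
      ((extChartAt (𝓡 2) x₀).target ×ˢ univ) := by
  have hfst : ContDiffOn ℝ ∞ (Prod.fst : Plane × Plane → Plane)
      ((extChartAt (𝓡 2) x₀).target ×ˢ univ) := contDiff_fst.contDiffOn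
  have hmaps : MapsTo (Prod.fst : Plane × Plane → Plane)
      ((extChartAt (𝓡 2) x₀).target ×ˢ univ) (extChartAt (𝓡 2) x₀).target := fun z hz ↦ hz.1
  have h1 : ContDiffOn ℝ ∞ (fun u ↦ κ ((extChartAt (𝓡 2) x₀).symm u))
      (extChartAt (𝓡 2) x₀).target :=
    (hκ.comp_contMDiffOn (contMDiffOn_extChartAt_symm (I := 𝓡 2) (n := ∞) x₀)).contDiffOn
  have h2 : ContDiffOn ℝ ∞ (fun u ↦ √(metricMatrix x₀ u).det) (extChartAt (𝓡 2) x₀).target :=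
    (contDiffOn_metricMatrix_det x₀).sqrt fun u hu ↦ (metricMatrix_det_pos hu).ne'
  have hsnd : ∀ i, ContDiff ℝ ∞ (fun z : Plane × Plane ↦ z.2 i) := fun i ↦
    (EuclideanSpace.proj i : Plane →L[ℝ] ℝ).contDiff.comp contDiff_snd
  have h3 : ContDiff ℝ ∞ (fun z : Plane × Plane ↦ z.2 0 * w 1 - z.2 1 * w 0) :=
    ((hsnd 0).mul contDiff_const).sub ((hsnd 1).mul contDiff_const)
  exact (((h1.comp hfst hmaps).mul ((contDiffOn_const.mul (h2.comp hfst hmaps)).mul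
    h3.contDiffOn)).sub (contDiffOn_fderiv_metricForm x₀ contDiff_snd contDiff_snd
      contDiff_const)).add (contDiffOn_const.mul
      (contDiffOn_fderiv_metricForm x₀ contDiff_const contDiff_snd contDiff_snd))

theorem contDiffOn_phaseField {κ : M → ℝ} (hκ : ContMDiff (𝓡 2) 𝓘(ℝ, ℝ) ∞ κ) (ε : ℝ) (x₀ : M) :
    ContDiffOn ℝ ∞ (phaseField κ ε x₀) ((extChartAt (𝓡 2) x₀).target ×ˢ univ) := by
  refine contDiff_snd.contDiffOn.prodMk (contDiffOn_euclidean.2 fun k ↦ ?_)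
  change ContDiffOn ℝ ∞ (fun z : Plane × Plane ↦ ∑ l, (metricMatrix x₀ z.1)⁻¹ k l *
    forceForm κ ε x₀ z.1 z.2 (EuclideanSpace.single l 1)) _
  exact ContDiffOn.sum fun l _ ↦ ((contDiffOn_metricMatrix_inv x₀ k l).comp
    contDiff_fst.contDiffOn (fun z hz ↦ hz.1)).mul (contDiffOn_forceForm hκ ε x₀ _)

end Field

/-! ### Conservation of speed -/

section Speed

variable {M : Type*} [TopologicalSpace M] [ChartedSpace Plane M] [IsManifold (𝓡 2) ∞ M]
  [RiemannianBundle (fun x : M ↦ TangentSpace (𝓡 2) x)]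

theorem IsMagneticGeodesicOn.contMDiffAt {o : SurfaceOrientation M} {κ : M → ℝ} {γ : ℝ → M}
    {s : Set ℝ} (h : IsMagneticGeodesicOn o κ γ s) (hs : IsOpen s) {t : ℝ} (ht : t ∈ s) :
    ContMDiffAt 𝓘(ℝ, ℝ) (𝓡 2) 2 γ t :=
  h.contMDiffOn.contMDiffAt (hs.mem_nhds ht)

variable [IsContMDiffRiemannianBundle (𝓡 2) ∞ Plane (fun x : M ↦ TangentSpace (𝓡 2) x)]

/-- The derivative is twice the acceleration paired with the velocity, that is `2 κ` times the area
form on the pair `(γ', γ')`, which vanishes. -/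
theorem IsMagneticGeodesicOn.hasDerivAt_speed_sq {o : SurfaceOrientation M} {κ : M → ℝ}
    {γ : ℝ → M} {s : Set ℝ} (h : IsMagneticGeodesicOn o κ γ s) (hs : IsOpen s) {t : ℝ}
    (ht : t ∈ s) : HasDerivAt (fun r ↦ ‖velocity γ r‖ ^ 2) 0 t := by
  have hγ := h.contMDiffAt hs ht
  have hsrc := mem_chart_source Plane (γ t)
  have hu : extChartAt (𝓡 2) (γ t) (γ t) ∈ (extChartAt (𝓡 2) (γ t)).target :=
    mem_extChartAt_target (γ t)
  have hd := hasDerivAt_metric_deriv_deriv (c := fun r ↦ extChartAt (𝓡 2) (γ t) (γ r))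
    (differentiableAt_metricForm hu) (fun v w ↦ metricForm_symm _ _ v w)
    (contDiffAt_chart_comp hγ hsrc)
  have heq := (covariantAcceleration_eq_iff o κ γ t).1 (h.equation t ht)
  rw [heq, ← velocity_eq_chartFrame (hγ.mdifferentiableAt two_ne_zero) hsrc, inner_rotation90,
    Orientation.areaForm_apply_self, mul_zero, mul_zero] at hd
  refine hd.congr_of_eventuallyEq ?_
  filter_upwards [hs.mem_nhds ht, hγ.continuousAt.preimage_mem_nhds
    ((chartAt Plane (γ t)).open_source.mem_nhds hsrc)] with r hr hr'
  rw [metricForm_eq_inner hr', ← velocity_eq_chartFrame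
    ((h.contMDiffAt hs hr).mdifferentiableAt two_ne_zero) hr', real_inner_self_eq_norm_sq]

theorem IsMagneticGeodesicOn.exists_speed_bound {o : SurfaceOrientation M} {κ : M → ℝ}
    {γ : ℝ → M} {s : Set ℝ} (h : IsMagneticGeodesicOn o κ γ s) (hs : IsOpen s)
    (hs' : IsPreconnected s) : ∃ C : NNReal, ∀ t ∈ s, ‖velocity γ t‖ ≤ C := by
  obtain ⟨a, ha⟩ := hs.exists_is_const_of_deriv_eq_zero hs'
    (fun t ht ↦ (h.hasDerivAt_speed_sq hs ht).differentiableAt.differentiableWithinAt)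
    (fun t ht ↦ (h.hasDerivAt_speed_sq hs ht).deriv)
  refine ⟨Real.toNNReal √a, fun t ht ↦ ?_⟩
  have h1 := ha t ht
  rw [Real.coe_toNNReal _ (Real.sqrt_nonneg a), ← h1, Real.sqrt_sq (norm_nonneg _)]

end Speed

/-! ### Limits at boundary times by completeness -/

section Limit

variable {M : Type*} [EMetricSpace M] [ChartedSpace Plane M]
  [RiemannianBundle (fun x : M ↦ TangentSpace (𝓡 2) x)] [IsRiemannianManifold (𝓡 2) M]

/-- The Riemannian distance between two points of the curve is at most the length of the arc joining
them, which is at most `C` times the elapsed time. -/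
theorem lipschitzOnWith_of_norm_velocity_le {γ : ℝ → M} {s : Set ℝ} (hs : s.OrdConnected)
    (hγ : ContMDiffOn 𝓘(ℝ, ℝ) (𝓡 2) 1 γ s) {C : NNReal} (hC : ∀ t ∈ s, ‖velocity γ t‖ ≤ C) :
    LipschitzOnWith C γ s := by
  have key : ∀ a ∈ s, ∀ b ∈ s, a ≤ b → edist (γ a) (γ b) ≤ C * edist a b := by
    intro a ha b hb hab
    rw [IsRiemannianManifold.out (I := 𝓡 2) (γ a) (γ b)]
    refine (Manifold.riemannianEDist_le_pathELength (hγ.mono (hs.out ha hb)) rfl rfl hab).trans ?_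
    rw [Manifold.pathELength_eq_lintegral_mfderiv_Icc]
    refine (MeasureTheory.setLIntegral_mono (g := fun _ ↦ (C : ENNReal)) measurable_const
      fun t ht ↦ ?_).trans ?_
    · rw [← ofReal_norm]
      exact (ENNReal.ofReal_le_ofReal (hC t (hs.out ha hb ht))).trans (by simp)
    · rw [MeasureTheory.setLIntegral_const, Real.volume_Icc, edist_comm, edist_dist, Real.dist_eq,
        abs_of_nonneg (sub_nonneg.2 hab)]
  intro a ha b hb
  rcases le_total a b with hab | hab
  · exact key a ha b hb hab
  · rw [edist_comm, edist_comm a]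
    exact key b hb a ha hab

/-- A uniformly continuous map sends the Cauchy filter `𝓝[s] b` to a Cauchy filter. -/
theorem exists_tendsto_nhdsWithin_of_lipschitzOnWith {α β : Type*} [PseudoEMetricSpace α]
    [PseudoEMetricSpace β] [CompleteSpace β] {C : NNReal} {f : α → β} {s : Set α}
    (hf : LipschitzOnWith C f s) {b : α} (hb : b ∈ closure s) :
    ∃ p, Tendsto f (𝓝[s] b) (𝓝 p) := by
  have := mem_closure_iff_nhdsWithin_neBot.1 hb
  refine CompleteSpace.complete ⟨inferInstance, ?_⟩
  have h := hf.uniformContinuousOn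
  rw [UniformContinuousOn] at h
  rw [prod_map_map_eq]
  refine h.mono_left (le_inf ?_ ?_)
  · exact (Filter.prod_mono inf_le_left inf_le_left).trans (nhds_prod_eq.symm.le.trans (nhds_le_uniformity b))
  · rw [← prod_principal_principal]
    exact Filter.prod_mono inf_le_right inf_le_right

variable [IsManifold (𝓡 2) ∞ M]
  [IsContMDiffRiemannianBundle (𝓡 2) ∞ Plane (fun x : M ↦ TangentSpace (𝓡 2) x)]

theorem IsMagneticGeodesicOn.exists_tendsto [CompleteSpace M] {o : SurfaceOrientation M}
    {κ : M → ℝ} {γ : ℝ → M} {s : Set ℝ} (h : IsMagneticGeodesicOn o κ γ s) (hs : IsOpen s)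
    (hs' : s.OrdConnected) {b : ℝ} (hb : b ∈ closure s) :
    ∃ p, Tendsto γ (𝓝[s] b) (𝓝 p) := by
  obtain ⟨C, hC⟩ := h.exists_speed_bound hs hs'.isPreconnected
  exact exists_tendsto_nhdsWithin_of_lipschitzOnWith (lipschitzOnWith_of_norm_velocity_le hs'
    (h.contMDiffOn.of_le (by norm_num)) hC) hb

end Limit

/-! ### Locality, and passage between solutions and phase curves -/

section Local

variable {M : Type*} [TopologicalSpace M] [ChartedSpace Plane M] [IsManifold (𝓡 2) ∞ M]
  [RiemannianBundle (fun x : M ↦ TangentSpace (𝓡 2) x)]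
  [IsContMDiffRiemannianBundle (𝓡 2) ∞ Plane (fun x : M ↦ TangentSpace (𝓡 2) x)]

omit [IsContMDiffRiemannianBundle (𝓡 2) ∞ Plane (fun x : M ↦ TangentSpace (𝓡 2) x)] in
theorem EquationInChart.congr {o : SurfaceOrientation M} {κ : M → ℝ} {x₀ : M} {γ γ' : ℝ → M}
    {t : ℝ} (h : EquationInChart o κ x₀ γ t) (hγ : MDifferentiableAt 𝓘(ℝ, ℝ) (𝓡 2) γ t)
    (ht : γ t ∈ (chartAt Plane x₀).source) (heq : γ' =ᶠ[𝓝 t] γ) :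
    EquationInChart o κ x₀ γ' t := by
  intro w
  have h1 := h w
  have hc : (fun s ↦ extChartAt (𝓡 2) x₀ (γ' s)) =ᶠ[𝓝 t] fun s ↦ extChartAt (𝓡 2) x₀ (γ s) :=
    heq.mono fun s hs ↦ congrArg _ hs
  have hpt : γ' t = γ t := heq.self_of_nhds
  rw [velocity_eq_chartFrame hγ ht] at h1
  rw [velocity_eq_chartFrame (hγ.congr_of_eventuallyEq heq) (by rw [hpt]; exact ht)]
  simp only [loweredAcceleration] at h1 ⊢
  rw [hc.deriv_eq, hc.deriv.deriv_eq, hpt]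
  exact h1

/-- Being a solution is a local property. -/
theorem IsMagneticGeodesicOn.of_locally {o : SurfaceOrientation M} {κ : M → ℝ} {γ : ℝ → M}
    {s : Set ℝ} (h : ∀ t ∈ s, ∃ u, IsOpen u ∧ t ∈ u ∧ ∃ γ', EqOn γ γ' u ∧
      IsMagneticGeodesicOn o κ γ' u) : IsMagneticGeodesicOn o κ γ s := by
  have hev : ∀ t ∈ s, ∃ γ', γ =ᶠ[𝓝 t] γ' ∧ ContMDiffAt 𝓘(ℝ, ℝ) (𝓡 2) 2 γ' t ∧
      EquationInChart o κ (γ' t) γ' t := by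
    intro t ht
    obtain ⟨u, hu, htu, γ', heq, h'⟩ := h t ht
    exact ⟨γ', heq.eventuallyEq_of_mem (hu.mem_nhds htu), h'.contMDiffAt hu htu,
      (covariantAcceleration_eq_iff o κ γ' t).1 (h'.equation t htu)⟩
  refine ⟨fun t ht ↦ ?_, fun t ht ↦ ?_⟩
  · obtain ⟨γ', heq, hγ', -⟩ := hev t ht
    exact (hγ'.congr_of_eventuallyEq heq).contMDiffWithinAt
  · obtain ⟨γ', heq, hγ', h'⟩ := hev t ht
    rw [covariantAcceleration_eq_iff, heq.self_of_nhds]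
    exact h'.congr (hγ'.mdifferentiableAt two_ne_zero) (mem_chart_source _ _) heq

theorem IsMagneticGeodesicOn.hasDerivAt_phase {o : SurfaceOrientation M} {κ : M → ℝ} {γ : ℝ → M}
    {s : Set ℝ} (h : IsMagneticGeodesicOn o κ γ s) (hs : IsOpen s) {ε : ℝ} {x₀ : M} {t : ℝ}
    (hts : t ∈ s) (ht : γ t ∈ (chartAt Plane x₀).source)
    (hε : (o.at_ (γ t)).areaForm (chartFrame x₀ (γ t) (EuclideanSpace.single 0 1))
        (chartFrame x₀ (γ t) (EuclideanSpace.single 1 1)) =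
      ε * √(metricMatrix x₀ (extChartAt (𝓡 2) x₀ (γ t))).det) :
    HasDerivAt (fun r ↦ (extChartAt (𝓡 2) x₀ (γ r), deriv (fun s ↦ extChartAt (𝓡 2) x₀ (γ s)) r))
      (phaseField κ ε x₀
        (extChartAt (𝓡 2) x₀ (γ t), deriv (fun s ↦ extChartAt (𝓡 2) x₀ (γ s)) t)) t := by
  have hγ := h.contMDiffAt hs hts
  have hc := contDiffAt_chart_comp hγ ht
  have heq := ((covariantAcceleration_eq_iff o κ γ t).1 (h.equation t hts)).change hγ ht
    (mem_chart_source _ _)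
  rw [equationInChart_iff hγ ht hε] at heq
  have h2 := (differentiableAt_deriv_of_contDiffAt_two hc).hasDerivAt
  rw [heq] at h2
  exact (hc.differentiableAt two_ne_zero).hasDerivAt.prodMk h2

/-- The first component of the system says that `(α t).2` is the coordinate velocity, so the second
component is the equation in the chart around `x₀`; it is then moved to the chart centred at the
curve. -/
theorem isMagneticGeodesicOn_of_phase {o : SurfaceOrientation M} {κ : M → ℝ}
    (hκ : ContMDiff (𝓡 2) 𝓘(ℝ, ℝ) ∞ κ) {ε : ℝ} {x₀ : M} {J : Set ℝ} (hJ : IsOpen J)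
    {α : ℝ → Plane × Plane} (hα : ∀ t ∈ J, HasDerivAt α (phaseField κ ε x₀ (α t)) t)
    (htar : ∀ t ∈ J, (α t).1 ∈ (extChartAt (𝓡 2) x₀).target)
    (hε : ∀ t ∈ J, (o.at_ ((extChartAt (𝓡 2) x₀).symm (α t).1)).areaForm
        (chartFrame x₀ ((extChartAt (𝓡 2) x₀).symm (α t).1) (EuclideanSpace.single 0 1))
        (chartFrame x₀ ((extChartAt (𝓡 2) x₀).symm (α t).1) (EuclideanSpace.single 1 1)) =
      ε * √(metricMatrix x₀ (α t).1).det) :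
    IsMagneticGeodesicOn o κ (fun t ↦ (extChartAt (𝓡 2) x₀).symm (α t).1) J := by
  have hmaps : MapsTo α J ((extChartAt (𝓡 2) x₀).target ×ˢ univ) := fun t ht ↦ ⟨htar t ht, trivial⟩
  have hF := contDiffOn_phaseField hκ ε x₀
  have hdiff : DifferentiableOn ℝ α J := fun t ht ↦
    (hα t ht).differentiableAt.differentiableWithinAt
  have hderiv : EqOn (deriv α) (fun t ↦ phaseField κ ε x₀ (α t)) J := fun t ht ↦ (hα t ht).deriv
  -- Bootstrapping: `α` is differentiable, hence continuous, so `α' = F(α)` is continuous; then `α`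
  -- is `C¹`, so `α'` is `C¹` and `α` is `C²`.
  have hC1 : ContDiffOn ℝ 1 α J := by
    rw [show (1 : WithTop ℕ∞) = 0 + 1 from rfl, contDiffOn_succ_iff_deriv_of_isOpen hJ]
    exact ⟨hdiff, by simp, ContDiffOn.congr (contDiffOn_zero.2
      (hF.continuousOn.comp hdiff.continuousOn hmaps)) hderiv⟩
  have hC2 : ContDiffOn ℝ 2 α J := by
    rw [show (2 : WithTop ℕ∞) = 1 + 1 from rfl, contDiffOn_succ_iff_deriv_of_isOpen hJ]
    exact ⟨hdiff, by simp, ContDiffOn.congr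
      ((hF.of_le (by norm_cast)).comp hC1 hmaps) hderiv⟩
  have hsm : ContMDiffOn 𝓘(ℝ, ℝ) (𝓡 2) 2 (fun t ↦ (extChartAt (𝓡 2) x₀).symm (α t).1) J :=
    (contMDiffOn_extChartAt_symm (I := 𝓡 2) (n := 2) x₀).comp
      (contMDiffOn_iff_contDiffOn.2 (contDiff_fst.comp_contDiffOn hC2)) htar
  refine ⟨hsm, fun t ht ↦ ?_⟩
  have hsrc : (extChartAt (𝓡 2) x₀).symm (α t).1 ∈ (chartAt Plane x₀).source := by
    simpa using (extChartAt (𝓡 2) x₀).map_target (htar t ht)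
  have hγ := hsm.contMDiffAt (hJ.mem_nhds ht)
  have hright : (fun s ↦ extChartAt (𝓡 2) x₀ ((extChartAt (𝓡 2) x₀).symm (α s).1)) =ᶠ[𝓝 t]
      fun s ↦ (α s).1 := by
    filter_upwards [hJ.mem_nhds ht] with s hs using (extChartAt (𝓡 2) x₀).right_inv (htar s hs)
  have hd1 : deriv (fun s ↦ (α s).1) =ᶠ[𝓝 t] fun s ↦ (α s).2 := by
    filter_upwards [hJ.mem_nhds ht] with s hs
    exact (hasFDerivAt_fst.comp_hasDerivAt s (hα s hs)).deriv
  rw [covariantAcceleration_eq_iff]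
  have hx := hε t ht
  rw [← (extChartAt (𝓡 2) x₀).right_inv (htar t ht), (extChartAt (𝓡 2) x₀).left_inv
    ((extChartAt (𝓡 2) x₀).map_target (htar t ht))] at hx
  refine EquationInChart.change ((equationInChart_iff (ε := ε) hγ hsrc hx).2 ?_) hγ
    (mem_chart_source _ _) hsrc
  rw [hright.deriv_eq, hright.deriv.deriv_eq, hd1.deriv_eq, hd1.self_of_nhds,
    (extChartAt (𝓡 2) x₀).right_inv (htar t ht)]
  exact (hasFDerivAt_snd.comp_hasDerivAt t (hα t ht)).deriv

end Local

/-! ### Extension past a boundary time -/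

section Extension

variable {M : Type*} [EMetricSpace M] [ChartedSpace Plane M] [IsManifold (𝓡 2) ∞ M]
  [RiemannianBundle (fun x : M ↦ TangentSpace (𝓡 2) x)]
  [IsContMDiffRiemannianBundle (𝓡 2) ∞ Plane (fun x : M ↦ TangentSpace (𝓡 2) x)]

/-- In a chart around the limit of a solution at a boundary point of its domain, position and
velocity have a common cluster point. -/
theorem IsMagneticGeodesicOn.exists_phase_cluster {o : SurfaceOrientation M}
    {κ : M → ℝ} {γ : ℝ → M} {s : Set ℝ} (h : IsMagneticGeodesicOn o κ γ s) (hs : IsOpen s)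
    (hs' : s.OrdConnected) {b : ℝ} (hb : b ∈ closure s) {p : M} (hp : Tendsto γ (𝓝[s] b) (𝓝 p)) :
    ∃ v : Plane, ∀ V ∈ 𝓝 (extChartAt (𝓡 2) p p, v), ∃ᶠ t in 𝓝[s] b,
      (extChartAt (𝓡 2) p (γ t), deriv (fun r ↦ extChartAt (𝓡 2) p (γ r)) t) ∈ V := by
  have := mem_closure_iff_nhdsWithin_neBot.1 hb
  obtain ⟨C, hC⟩ := h.exists_speed_bound hs hs'.isPreconnected
  have : IsContinuousRiemannianBundle Plane (fun x : M ↦ TangentSpace (𝓡 2) x) := by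
    obtain ⟨g, hg, hg'⟩ := IsContMDiffRiemannianBundle.exists_contMDiff (IB := 𝓡 2) (n := ∞)
      (F := Plane) (E := fun x : M ↦ TangentSpace (𝓡 2) x)
    exact ⟨g, hg.continuous, hg'⟩
  -- Near `p` the trivialization has norm below `D`, so a speed of at most `C` gives coordinate
  -- velocities in a fixed compact ball.
  obtain ⟨D, -, hD⟩ := eventually_norm_trivializationAt_lt Plane
    (fun x : M ↦ TangentSpace (𝓡 2) x) p
  have hbound : ∀ᶠ t in 𝓝[s] b, deriv (fun r ↦ extChartAt (𝓡 2) p (γ r)) t ∈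
      Metric.closedBall (0 : Plane) (D * C) := by
    filter_upwards [hp.eventually hD, hp.eventually (chart_source_mem_nhds Plane p),
      self_mem_nhdsWithin] with t h1 h2 h3
    have h4 := velocity_eq_chartFrame ((h.contMDiffAt hs h3).mdifferentiableAt two_ne_zero) h2
    have h5 := (trivializationAt Plane (TangentSpace (𝓡 2) : M → Type _)
      p).continuousLinearMapAt_symmL (R := ℝ) (b := γ t) h2
        (deriv (fun r ↦ extChartAt (𝓡 2) p (γ r)) t)
    have h6 : (trivializationAt Plane (TangentSpace (𝓡 2) : M → Type _)
      p).continuousLinearMapAt ℝ (γ t) (velocity γ t) =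
        deriv (fun r ↦ extChartAt (𝓡 2) p (γ r)) t := by
      rw [h4]
      exact h5
    rw [mem_closedBall_zero_iff, ← h6]
    exact (ContinuousLinearMap.le_opNorm _ _).trans
      (mul_le_mul h1.le (hC t h3) (norm_nonneg _) ((norm_nonneg _).trans h1.le))
  obtain ⟨v, -, hv⟩ := (isCompact_closedBall (0 : Plane) (D * C)).exists_mapClusterPt_of_frequently
    hbound.frequently
  refine ⟨v, fun V hV ↦ ?_⟩
  obtain ⟨A, hA, B, hB, hAB⟩ := mem_nhds_prod_iff.1 hV
  have hcA : ∀ᶠ t in 𝓝[s] b, extChartAt (𝓡 2) p (γ t) ∈ A :=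
    ((continuousAt_extChartAt (I := 𝓡 2) p).tendsto.comp hp).eventually hA
  exact ((mapClusterPt_iff_frequently.1 hv B hB).and_eventually hcA).mono
    fun t ht ↦ hAB ⟨ht.2, ht.1⟩

variable [IsRiemannianManifold (𝓡 2) M] [CompleteSpace M]

/-- A solution on an open interval of a complete surface extends past each boundary time. -/
theorem IsMagneticGeodesicOn.exists_extension_past {o : SurfaceOrientation M} {κ : M → ℝ}
    (hκ : ContMDiff (𝓡 2) 𝓘(ℝ, ℝ) ∞ κ) {γ : ℝ → M} {s : Set ℝ}
    (h : IsMagneticGeodesicOn o κ γ s) (hs : IsOpen s) (hs' : s.OrdConnected) {b : ℝ}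
    (hb : b ∈ closure s) :
    ∃ (s' : Set ℝ) (γ' : ℝ → M), IsOpen s' ∧ s'.OrdConnected ∧ s ⊆ s' ∧ b ∈ s' ∧
      EqOn γ' γ s ∧ IsMagneticGeodesicOn o κ γ' s' := by
  classical
  obtain ⟨p, hp⟩ := h.exists_tendsto hs hs' hb
  obtain ⟨v, hv⟩ := h.exists_phase_cluster hs hs' hb hp
  obtain ⟨ε, hε⟩ := exists_eventually_areaForm_eq o p
  set φ := extChartAt (𝓡 2) p with hφ
  set c : ℝ → Plane := fun r ↦ φ (γ r) with hc
  have htarget : ∀ᶠ z : Plane × Plane in 𝓝 (φ p, v), z.1 ∈ φ.target :=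
    (continuous_fst.tendsto (φ p, v)).eventually (extChartAt_target_mem_nhds (I := 𝓡 2) p)
  have hU : ∀ᶠ z : Plane × Plane in 𝓝 (φ p, v), z.1 ∈ φ.target ∧
      (o.at_ (φ.symm z.1)).areaForm (chartFrame p (φ.symm z.1) (EuclideanSpace.single 0 1))
        (chartFrame p (φ.symm z.1) (EuclideanSpace.single 1 1)) =
      ε * √(metricMatrix p z.1).det := by
    have hcont : ContinuousAt (fun z : Plane × Plane ↦ φ.symm z.1) (φ p, v) :=
      ContinuousAt.comp (g := φ.symm) (f := Prod.fst) (x := (φ p, v))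
        (continuousAt_extChartAt_symm p) continuous_fst.continuousAt
    have h1 : Tendsto (fun z : Plane × Plane ↦ φ.symm z.1) (𝓝 (φ p, v)) (𝓝 p) := by
      have := hcont.tendsto
      rwa [show φ.symm (φ p, v).1 = p from extChartAt_to_inv p] at this
    filter_upwards [htarget, h1.eventually hε] with z hz1 hz2
    rw [φ.right_inv hz1] at hz2
    exact ⟨hz1, hz2⟩
  have hFopen : IsOpen (φ.target ×ˢ (univ : Set Plane)) :=
    (isOpen_extChartAt_target p).prod isOpen_univ
  have hF : ∀ z : Plane × Plane, z.1 ∈ φ.target → ContDiffAt ℝ 1 (phaseField κ ε p) z :=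
    fun z hz ↦ ((contDiffOn_phaseField hκ ε p).contDiffAt
      (hFopen.mem_nhds ⟨hz, trivial⟩)).of_le (by norm_cast)
  obtain ⟨ε₀, hε₀, V, hV, hsol⟩ := exists_uniform_local_solution
    (hF (φ p, v) (mem_extChartAt_target p)) hU
  obtain ⟨δ, hδ, hδs⟩ := Metric.mem_nhdsWithin_iff.1
    (hp.eventually (hε.and (chart_source_mem_nhds Plane p)))
  -- The lifetime is cut to `δ / 2` so that `J`, centred within `δ / 2` of `b`, stays in the ball of
  -- radius `δ` around `b`; there `γ` remains in the chart and the formula for the area form holds.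
  have hmin : 0 < min ε₀ (δ / 2) := lt_min hε₀ (half_pos hδ)
  -- The time `t₀` is closer to `b` than the lifetime of solutions starting in `V`, so the solution
  -- through the phase point of `γ` at `t₀` is still defined at `b`. A cluster point suffices: one
  -- such time is enough. Lifetimes are two-sided, so `b` may be either end of `s`.
  obtain ⟨t₀, ⟨ht₀V, ht₀s⟩, ht₀b⟩ := (((hv V hV).and_eventually self_mem_nhdsWithin).and_eventually
    (mem_nhdsWithin_of_mem_nhds (Metric.ball_mem_nhds b hmin))).exists
  obtain ⟨α, hα0, hα⟩ := hsol _ hmin (min_le_left _ _) t₀ _ ht₀V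
  set J := Ioo (t₀ - min ε₀ (δ / 2)) (t₀ + min ε₀ (δ / 2)) with hJ
  have ht₀J : t₀ ∈ J := ⟨by linarith, by linarith⟩
  have ht₀b' := abs_lt.1 (Real.dist_eq t₀ b ▸ Metric.mem_ball.1 ht₀b)
  have hbJ : b ∈ J := ⟨by linarith [ht₀b'.2], by linarith [ht₀b'.1]⟩
  have hIN : ∀ t ∈ s ∩ J, _ := fun t ht ↦ hδs (show t ∈ Metric.ball b δ ∩ s by
    refine ⟨?_, ht.1⟩
    have h2 := min_le_right ε₀ (δ / 2)
    rw [Metric.mem_ball, Real.dist_eq, abs_lt]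
    constructor <;> linarith [ht.2.1, ht.2.2, ht₀b'.1, ht₀b'.2])
  -- Both phase curves solve the same system on the interval `s ∩ J` and agree at `t₀`.
  have hI : EqOn (fun t ↦ (c t, deriv c t)) α (s ∩ J) :=
    eqOn_of_solutions (F := phaseField κ ε p) (hs'.inter ordConnected_Ioo).isPreconnected
      (hs.inter isOpen_Ioo)
      (fun t ht ↦ hF _ (φ.map_source (by rw [hφ, extChartAt_source]; exact (hIN t ht).2)))
      (fun t ht ↦ h.hasDerivAt_phase hs ht.1 (hIN t ht).2 (hIN t ht).1)
      (fun t ht ↦ (hα t ht.2).1) ⟨ht₀s, ht₀J⟩ hα0.symm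
  have hγ₂ := isMagneticGeodesicOn_of_phase hκ (o := o) (ε := ε) (x₀ := p) (J := J) isOpen_Ioo
    (fun t ht ↦ (hα t ht).1) (fun t ht ↦ (hα t ht).2.1) (fun t ht ↦ (hα t ht).2.2)
  set γ₂ : ℝ → M := fun t ↦ φ.symm (α t).1 with hγ₂def
  have hΓs : EqOn (s.piecewise γ γ₂) γ s := piecewise_eqOn _ _ _
  have hΓJ : EqOn (s.piecewise γ γ₂) γ₂ J := by
    intro t ht
    by_cases hts : t ∈ s
    · rw [hΓs hts, hγ₂def]
      change γ t = φ.symm (α t).1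
      rw [← hI ⟨hts, ht⟩]
      exact (φ.left_inv (by rw [hφ, extChartAt_source]; exact (hIN t ⟨hts, ht⟩).2)).symm
    · exact piecewise_eq_of_notMem _ _ _ hts
  refine ⟨s ∪ J, s.piecewise γ γ₂, hs.union isOpen_Ioo,
    (hs'.isPreconnected.union t₀ ht₀s ht₀J isPreconnected_Ioo).ordConnected, subset_union_left,
    Or.inr hbJ, hΓs, IsMagneticGeodesicOn.of_locally ?_⟩
  rintro t (ht | ht)
  · exact ⟨s, hs, ht, γ, hΓs, h⟩
  · exact ⟨J, isOpen_Ioo, ht, γ₂, hΓJ, hγ₂⟩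

end Extension

/-! ### Maximal solutions by Zorn's lemma -/

section Maximal

variable {M : Type*} [TopologicalSpace M] [ChartedSpace Plane M] [IsManifold (𝓡 2) ∞ M]
  [RiemannianBundle (fun x : M ↦ TangentSpace (𝓡 2) x)]
  [IsContMDiffRiemannianBundle (𝓡 2) ∞ Plane (fun x : M ↦ TangentSpace (𝓡 2) x)]

/-- If every solution extends past each boundary point of its interval, then every solution
extends to the whole line. -/
theorem exists_global_of_exists_extension {o : SurfaceOrientation M} {κ : M → ℝ}
    (hext : ∀ (s : Set ℝ) (γ : ℝ → M), IsOpen s → s.OrdConnected → IsMagneticGeodesicOn o κ γ s →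
      ∀ b ∈ closure s, ∃ (s' : Set ℝ) (γ' : ℝ → M), IsOpen s' ∧ s'.OrdConnected ∧ s ⊆ s' ∧ b ∈ s' ∧
        EqOn γ' γ s ∧ IsMagneticGeodesicOn o κ γ' s')
    {s : Set ℝ} {γ : ℝ → M} (hs : IsOpen s) (hs' : s.OrdConnected) (hne : s.Nonempty)
    (h : IsMagneticGeodesicOn o κ γ s) :
    ∃ Γ : ℝ → M, IsMagneticGeodesicOn o κ Γ univ ∧ EqOn Γ γ s := by
  classical
  let P := {q : Set ℝ × (ℝ → M) // IsOpen q.1 ∧ q.1.OrdConnected ∧ IsMagneticGeodesicOn o κ q.2 q.1 ∧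
    s ⊆ q.1 ∧ EqOn q.2 γ s}
  -- This relation is only a preorder, because values outside the interval are arbitrary; Zorn's
  -- lemma is used in the form that needs transitivity alone.
  let r : P → P → Prop := fun q q' ↦ q.1.1 ⊆ q'.1.1 ∧ EqOn q'.1.2 q.1.2 q.1.1
  have hchain : ∀ C : Set P, IsChain r C → ∃ ub : P, ∀ q ∈ C, r q ub := by
    intro C hC
    rcases C.eq_empty_or_nonempty with rfl | ⟨q₀, hq₀⟩
    · exact ⟨⟨(s, γ), hs, hs', h, Subset.rfl, fun _ _ ↦ rfl⟩, by simp⟩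
    have htot : ∀ q ∈ C, ∀ q' ∈ C, r q q' ∨ r q' q := by
      intro q hq q' hq'
      by_cases hqq : q = q'
      · subst hqq
        exact Or.inl ⟨Subset.rfl, fun _ _ ↦ rfl⟩
      · exact hC hq hq' hqq
    let Γ : ℝ → M := fun t ↦ if ht : ∃ q ∈ C, t ∈ q.1.1 then ht.choose.1.2 t else γ t
    have hΓ : ∀ q ∈ C, EqOn Γ q.1.2 q.1.1 := by
      intro q hq t ht
      have hex : ∃ q ∈ C, t ∈ q.1.1 := ⟨q, hq, ht⟩
      have hspec := hex.choose_spec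
      have hval : Γ t = hex.choose.1.2 t := dif_pos hex
      rw [hval]
      rcases htot _ hspec.1 q hq with h1 | h1
      · exact (h1.2 hspec.2).symm
      · exact h1.2 ht
    refine ⟨⟨(⋃ q ∈ C, q.1.1, Γ), ?_, ?_, ?_, ?_, ?_⟩, fun q hq ↦
      ⟨subset_biUnion_of_mem (u := fun q : P ↦ q.1.1) hq, hΓ q hq⟩⟩
    · exact isOpen_biUnion fun q _ ↦ q.2.1
    · refine ⟨fun x hx y hy ↦ ?_⟩
      simp only [mem_iUnion, exists_prop] at hx hy
      obtain ⟨q, hq, hxq⟩ := hx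
      obtain ⟨q', hq', hyq⟩ := hy
      rcases htot q hq q' hq' with h1 | h1
      · exact (q'.2.2.1.out (h1.1 hxq) hyq).trans
          (subset_biUnion_of_mem (u := fun q : P ↦ q.1.1) hq')
      · exact (q.2.2.1.out hxq (h1.1 hyq)).trans
          (subset_biUnion_of_mem (u := fun q : P ↦ q.1.1) hq)
    · refine IsMagneticGeodesicOn.of_locally fun t ht ↦ ?_
      simp only [mem_iUnion, exists_prop] at ht
      obtain ⟨q, hq, htq⟩ := ht
      exact ⟨q.1.1, q.2.1, htq, q.1.2, hΓ q hq, q.2.2.2.1⟩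
    · exact q₀.2.2.2.2.1.trans (subset_biUnion_of_mem (u := fun q : P ↦ q.1.1) hq₀)
    · exact fun t ht ↦ (hΓ q₀ hq₀ (q₀.2.2.2.2.1 ht)).trans (q₀.2.2.2.2.2 ht)
  obtain ⟨m, hm⟩ := exists_maximal_of_chains_bounded hchain
    (fun {a b c} hab hbc ↦ ⟨hab.1.trans hbc.1, fun t ht ↦ (hbc.2 (hab.1 ht)).trans (hab.2 ht)⟩)
  obtain ⟨⟨T, Γ⟩, hT, hT', hΓ, hsT, hΓγ⟩ := m
  -- An extension past `b` is itself a competitor, so maximality forces `b` into `T`. The interval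
  -- is then open, closed and nonempty in the connected line.
  have hclosed : IsClosed T := by
    refine isClosed_of_closure_subset fun b hb ↦ ?_
    obtain ⟨s', γ', h1, h2, h3, h4, h5, h6⟩ := hext T Γ hT hT' hΓ b hb
    exact (hm ⟨(s', γ'), h1, h2, h6, hsT.trans h3, fun t ht ↦ (h5 (hsT ht)).trans (hΓγ ht)⟩
      ⟨h3, h5⟩).1 h4
  have huniv : T = univ := IsClopen.eq_univ ⟨hclosed, hT⟩ (hne.mono hsT)
  subst huniv
  exact ⟨Γ, hΓ, hΓγ⟩

end Maximal

end MagneticGeodesic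
theorem theorem2p1
    {M : Type*} [EMetricSpace M] [ChartedSpace (EuclideanSpace ℝ (Fin 2)) M]
    [IsManifold (𝓡 2) ∞ M]
    [RiemannianBundle (fun x : M ↦ TangentSpace (𝓡 2) x)]
    [IsContMDiffRiemannianBundle (𝓡 2) ∞ (EuclideanSpace ℝ (Fin 2))
      (fun x : M ↦ TangentSpace (𝓡 2) x)]
    [IsRiemannianManifold (𝓡 2) M] [CompleteSpace M]
    (o : MagneticGeodesic.SurfaceOrientation M)
    (κ : M → ℝ) (hκ : ContMDiff (𝓡 2) 𝓘(ℝ, ℝ) ∞ κ) (hκb : ∃ C : ℝ, ∀ x, |κ x| ≤ C)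
    (s : Set ℝ) (hs_open : IsOpen s) (hs_conn : s.OrdConnected) (hs_ne : s.Nonempty)
    (γ : ℝ → M) (hγ : MagneticGeodesic.IsMagneticGeodesicOn o κ γ s) :
    ∃ Γ : ℝ → M, MagneticGeodesic.IsMagneticGeodesicOn o κ Γ Set.univ ∧ Set.EqOn Γ γ s := by
  exact MagneticGeodesic.exists_global_of_exists_extension
    (fun _ _ h1 h2 h3 _ hb ↦ h3.exists_extension_past hκ h1 h2 hb) hs_open hs_conn hs_ne hγ
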